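/- Let $q\ge 3$ be a prime power, let $n\ge 2$, and let $\mathbb F_q^n$ be the $n$-dimensional vector space over the finite field $\mathbb F_q$. A line of $\mathbb F_q^n$ is a coset of a one-dimensional linear subspace. For a permutation $f$ of the set $\mathbb F_q^n$, let $1\text{-affinity}(f)$ be the number of lines $L$ such that $f(L)$ is a line, and let $1\text{-coaffinity}(f)$ be the number of lines $L$ such that $f(L)$ is not a line. Call $f$ semi-affine if there are a field automorphism $\sigma$ of $\mathbb F_q$, an additive automorphism $g$ of $\mathbb F_q^n$ with $g(\alpha x)=\sigma(\alpha)g(x)$ for all $\alpha\in\mathbb F_q$, $x\in\mathbb F_q^n$, and a vector $b\in\mathbb F_q^n$ such that $f(x)=g(x)+b$ for all $x$. Write $\genfrac{[}{]}{0pt}{}{m}{1}_q=\frac{q^m-1}{q-1}$. Then the following hold. (1) If a permutation $f$ of $\mathbb F_q^n$ satisfies $$1\text{-coaffinity}(f)<2q\genfrac{[}{]}{0pt}{}{n-1}{1}_q ,$$ then $1\text{-coaffinity}(f)=0$, that is, $f$ maps every line to a line; moreover, $f$ is semi-affine. (2) If a permutation $f$ of $\mathbb F_q^n$ satisfies $$1\text{-affinity}(f)>\frac{(q^{n-1}-2)(q^n-1)}{q-1}+2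 ,$$ then $1\text{-affinity}(f)=q^{n-1}\genfrac{[}{]}{0pt}{}{n}{1}_q$, the total number of lines in $\mathbb F_q^n$. (3) The next to largest $1$-affinity is that of a transposition: for every transposition $\tau$ of $\mathbb F_q^n$ (a permutation interchanging two distinct points and fixing all the others), $1\text{-affinity}(\tau)$ is the largest element of the set of all values $1\text{-affinity}(f)$, $f$ a permutation of $\mathbb F_q^n$, that are smaller than $q^{n-1}\genfrac{[}{]}{0pt}{}{n}{1}_q$. -/

import Mathlib

noncomputable section

/-- The `q`-binomial coefficient
`((q ^ n - 1) (q ^ (n - 1) - 1) ⋯ (q ^ (n - k + 1) - 1)) / ((q ^ k - 1) ⋯ (q - 1))`,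
as a rational number. -/
def qBinomial (q n k : ℕ) : ℚ :=
  (∏ i ∈ Finset.range k, ((q : ℚ) ^ (n - i) - 1)) /
    ∏ i ∈ Finset.range k, ((q : ℚ) ^ (k - i) - 1)

/-- A `k`-flat of `F ^ n` is a coset `U + x` of a `k`-dimensional linear subspace `U`. -/
def IsFlat {F : Type*} [Field F] {n : ℕ} (k : ℕ) (X : Set (Fin n → F)) : Prop :=
  ∃ (U : Submodule F (Fin n → F)) (x : Fin n → F),
    Module.finrank F U = k ∧ X = (fun u => u + x) '' (U : Set (Fin n → F))

/-- The number of `k`-flats `X` such that `f(X)` is a `k`-flat. -/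
def kAffinity {F : Type*} [Field F] {n : ℕ} (k : ℕ) (f : Equiv.Perm (Fin n → F)) : ℕ :=
  {X : Set (Fin n → F) | IsFlat k X ∧ IsFlat k (f '' X)}.ncard

/-- The number of `k`-flats `X` such that `f(X)` is not a `k`-flat. -/
def kCoaffinity {F : Type*} [Field F] {n : ℕ} (k : ℕ) (f : Equiv.Perm (Fin n → F)) : ℕ :=
  {X : Set (Fin n → F) | IsFlat k X ∧ ¬ IsFlat k (f '' X)}.ncard

/-- The set of all `k`-affinities of permutations of `F ^ n`. -/
def kSpectrum (F : Type*) [Field F] (n k : ℕ) : Set ℕ :=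
  Set.range fun f : Equiv.Perm (Fin n → F) => kAffinity k f

/-- `f` is semi-affine: `f(x) = g(x) + b` with `g` an additive automorphism of `F ^ n` that is
semilinear with respect to some automorphism `σ` of `F`. -/
def IsSemiAffine {F : Type*} [Field F] {n : ℕ} (f : Equiv.Perm (Fin n → F)) : Prop :=
  ∃ (σ : F ≃+* F) (g : (Fin n → F) ≃+ (Fin n → F)) (b : Fin n → F),
    (∀ (α : F) (x : Fin n → F), g (α • x) = σ α • g x) ∧ ∀ x, f x = g x + b

end

/-! Call a line bad if its image under `f` is not a line, and good otherwise. Everything rests on a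
gap: if N = (q^(n-1) - 1)/(q - 1) is the number of planes containing a given line, then fewer than
2qN bad lines means none (`badLines_eq_empty`). A point lies on M = qN + 1 lines and there are
q^(n-1) M lines in all, so the bounds in (1) and (2) both say that fewer than 2qN lines are bad. A
transposition has at most 2(M - 1) = 2qN bad lines, so it realizes the gap, which is (3).
Semi-affinity is then the fundamental theorem of affine geometry (`exists_semilinear`).

To prove the gap, double counting gives a point on at most two bad lines; translations make it the
origin and make `f` fix it. Exactly one bad line through 0 is impossible, since the good lines
through 0 force its image to be closed under scalars (`good_of_all_others_good`).

Suppose two lines A, B through 0 are bad. Then f(A ∪ B) is again a union of two lines A', B'. A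
plane containing exactly one of A, B has at least q bad lines off 0 (`card_badLinesOff_of_one_bad`),
and the plane containing both has at least 2(q - 1) (`card_badLinesOff_of_two_bad`). A line off 0
lies in only one plane through 0, so the counts add up to 2(N - 1)q + 2(q - 1) + 2 = 2qN.

Suppose no line through 0 is bad. A plane through 0 with a bad line has at least 2q of them
(`card_badLinesOff_of_good`), so fewer than N planes are bad. For x, y in a bad plane P, a count
yields z outside P such that the planes of (x + y, z), (x, y + z) and (y, z) are all good. In a good
plane `f` is additive, and associativity gives f(x + y) = f(x) + f(y). Hence `f` is additive on
independent pairs of P, which makes the lines of P good: a contradiction. -/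

namespace LineAffinity

open scoped Classical

/-! ### Lines, planes and independent pairs in a vector space. -/

section Basics

variable {F V : Type*} [Field F] [AddCommGroup V] [Module F V]

variable (F) in
/-- The set of points `x + t • v`; it is a line when `v ≠ 0`. -/
def line (x v : V) : Set V := Set.range fun t : F => x + t • v

variable (F) in
/-- A line of the vector space `V`. -/
def IsLine (L : Set V) : Prop := ∃ x v : V, v ≠ 0 ∧ L = line F x v

theorem mem_line {x v z : V} : z ∈ line F x v ↔ ∃ t : F, x + t • v = z := Iff.rfl

theorem left_mem_line (x v : V) : x ∈ line F x v := ⟨0, by simp⟩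

theorem add_mem_line (x v : V) : x + v ∈ line F x v := ⟨1, by simp⟩

theorem mem_line_zero {v z : V} : z ∈ line F 0 v ↔ ∃ t : F, t • v = z := by simp [mem_line]

theorem isLine_line (x : V) {v : V} (hv : v ≠ 0) : IsLine F (line F x v) := ⟨x, v, hv, rfl⟩

theorem line_eq_of_mem {x v y : V} (h : y ∈ line F x v) : line F x v = line F y v := by
  obtain ⟨s, rfl⟩ := h
  ext z
  constructor
  · rintro ⟨t, rfl⟩
    exact ⟨t - s, by module⟩
  · rintro ⟨t, rfl⟩
    exact ⟨t + s, by module⟩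

theorem line_smul (x v : V) {c : F} (hc : c ≠ 0) : line F x (c • v) = line F x v := by
  ext z
  constructor
  · rintro ⟨t, rfl⟩
    exact ⟨t * c, by simp [mul_smul]⟩
  · rintro ⟨t, rfl⟩
    exact ⟨t / c, by simp [smul_smul, hc]⟩

theorem IsLine.exists_eq {L : Set V} (hL : IsLine F L) {x : V} (hx : x ∈ L) :
    ∃ v : V, v ≠ 0 ∧ L = line F x v := by
  obtain ⟨y, v, hv, rfl⟩ := hL
  exact ⟨v, hv, line_eq_of_mem hx⟩

theorem IsLine.eq_line {L : Set V} (hL : IsLine F L) {x y : V} (hx : x ∈ L) (hy : y ∈ L)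
    (hxy : x ≠ y) : L = line F x (y - x) := by
  obtain ⟨v, hv, rfl⟩ := hL.exists_eq hx
  obtain ⟨t, rfl⟩ := hy
  have ht : t ≠ 0 := by
    rintro rfl
    simp at hxy
  simp only [add_sub_cancel_left]
  rw [line_smul _ _ ht]

theorem IsLine.eq_of_mem {L M : Set V} (hL : IsLine F L) (hM : IsLine F M) {x y : V}
    (hxy : x ≠ y) (hxL : x ∈ L) (hyL : y ∈ L) (hxM : x ∈ M) (hyM : y ∈ M) : L = M := by
  rw [hL.eq_line hxL hyL hxy, hM.eq_line hxM hyM hxy]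

theorem IsLine.subset_submodule {L : Set V} (hL : IsLine F L) {x y : V} (hxy : x ≠ y)
    (hx : x ∈ L) (hy : y ∈ L) {Q : Submodule F V} (hxQ : x ∈ Q) (hyQ : y ∈ Q) :
    L ⊆ Q := by
  rw [hL.eq_line hx hy hxy]
  rintro _ ⟨t, rfl⟩
  exact Q.add_mem hxQ (Q.smul_mem _ (Q.sub_mem hyQ hxQ))

theorem line_subset_submodule {x v : V} {Q : Submodule F V} (hx : x ∈ Q) (hv : v ∈ Q) :
    line F x v ⊆ Q := by
  rintro _ ⟨t, rfl⟩
  exact Q.add_mem hx (Q.smul_mem _ hv)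

theorem image_add_line (a x v : V) : (fun z => a + z) '' line F x v = line F (a + x) v := by
  ext z
  constructor
  · rintro ⟨_, ⟨t, rfl⟩, rfl⟩
    exact ⟨t, by module⟩
  · rintro ⟨t, rfl⟩
    exact ⟨_, ⟨t, rfl⟩, by module⟩

theorem IsLine.image_add {L : Set V} (hL : IsLine F L) (a : V) :
    IsLine F ((fun z => a + z) '' L) := by
  obtain ⟨x, v, hv, rfl⟩ := hL
  exact ⟨a + x, v, hv, image_add_line a x v⟩

theorem isLine_image_add_iff {L : Set V} (a : V) :
    IsLine F ((fun z => a + z) '' L) ↔ IsLine F L := by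
  refine ⟨fun h => ?_, fun h => h.image_add a⟩
  have := h.image_add (-a)
  rwa [Set.image_image, show (fun z : V => -a + (a + z)) = id by ext; simp, Set.image_id] at this

theorem line_zero_eq_of_mem {v w : V} (hw : w ∈ line F 0 v) (hw0 : w ≠ 0) :
    line F 0 v = line F 0 w := by
  obtain ⟨t, rfl⟩ := mem_line_zero.1 hw
  rw [line_smul]
  rintro rfl
  simp at hw0

theorem smul_mem_line_zero {v w : V} (hw : w ∈ line F 0 v) (c : F) : c • w ∈ line F 0 v := by
  obtain ⟨t, rfl⟩ := mem_line_zero.1 hw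
  exact ⟨c * t, by simp [mul_smul]⟩

theorem IsLine.eq_line_zero {L : Set V} (hL : IsLine F L) (h0 : (0 : V) ∈ L) {v : V} (hv : v ∈ L)
    (hv0 : v ≠ 0) : L = line F 0 v := by
  rw [hL.eq_line h0 hv hv0.symm, sub_zero]

theorem indep_iff {u w : V} (hu : u ≠ 0) :
    LinearIndependent F ![u, w] ↔ w ∉ line F 0 u := by
  rw [LinearIndependent.pair_iff' hu, mem_line_zero]
  push Not
  rfl

theorem finrank_span_pair {u w : V} (h : LinearIndependent F ![u, w]) :
    Module.finrank F (Submodule.span F {u, w}) = 2 := by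
  have h1 := finrank_span_eq_card h
  have h2 : Set.range ![u, w] = {u, w} := by
    ext z
    simp [eq_comm, or_comm]
  rwa [h2] at h1

theorem span_eq_of_indep {P : Submodule F V} (hP : Module.finrank F P = 2) {u w : V}
    (hu : u ∈ P) (hw : w ∈ P) (h : LinearIndependent F ![u, w]) :
    Submodule.span F {u, w} = P := by
  have : FiniteDimensional F P := FiniteDimensional.of_finrank_pos (by omega)
  apply Submodule.eq_of_le_of_finrank_eq
  · rw [Submodule.span_le]
    rintro x (rfl | rfl) <;> assumption
  · rw [hP]
    exact finrank_span_pair h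

theorem exists_mem_notMem_line {P : Submodule F V} (hP : 2 ≤ Module.finrank F P) (u : V) :
    ∃ w ∈ P, w ∉ line F 0 u := by
  by_contra! h
  have hle : P ≤ Submodule.span F {u} := by
    intro w hw
    obtain ⟨t, ht⟩ := mem_line_zero.1 (h w hw)
    exact Submodule.mem_span_singleton.2 ⟨t, ht⟩
  have h1 := Submodule.finrank_mono hle
  have h2 : Module.finrank F (Submodule.span F {u}) ≤ 1 := by
    simpa using finrank_span_le_card (R := F) ({u} : Set V)
  omega

theorem indep_mem_combo {P : Submodule F V} (hP : Module.finrank F P = 2) {u w z : V}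
    (hu : u ∈ P) (hw : w ∈ P) (h : LinearIndependent F ![u, w]) (hz : z ∈ P) :
    ∃ a b : F, a • u + b • w = z := by
  rw [← span_eq_of_indep hP hu hw h] at hz
  exact Submodule.mem_span_pair.1 hz

theorem indep_left_ne_zero {u w : V} (h : LinearIndependent F ![u, w]) : u ≠ 0 := h.ne_zero 0

theorem indep_right_ne_zero {u w : V} (h : LinearIndependent F ![u, w]) : w ≠ 0 := h.ne_zero 1

theorem mem_line_zero_self (v : V) : v ∈ line F 0 v := by
  simpa using add_mem_line (F := F) 0 v

theorem indep_symm {u w : V} (h : LinearIndependent F ![u, w]) : LinearIndependent F ![w, u] :=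
  LinearIndependent.pair_symm_iff.1 h

theorem eq_zero_of_mem_of_mem {u w z : V} (h : LinearIndependent F ![u, w])
    (h1 : z ∈ line F 0 u) (h2 : z ∈ line F 0 w) : z = 0 := by
  by_contra hz0
  have := (line_zero_eq_of_mem h1 hz0).trans (line_zero_eq_of_mem h2 hz0).symm
  rw [indep_iff (indep_left_ne_zero h)] at h
  exact h (this ▸ mem_line_zero_self w)

/-- The lines not parallel to `a` in the plane spanned by `a`, `b`. -/
theorem line_smul_add_injective {a b : V} (h : LinearIndependent F ![a, b]) {t s t' s' : F}
    (he : line F (t • a) (b + s • a) = line F (t' • a) (b + s' • a)) : t = t' ∧ s = s' := by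
  rw [LinearIndependent.pair_iff] at h
  have h1 : t • a ∈ line F (t' • a) (b + s' • a) := he ▸ left_mem_line _ _
  have h2 : t • a + (b + s • a) ∈ line F (t' • a) (b + s' • a) := he ▸ add_mem_line _ _
  obtain ⟨c, hc⟩ := h1
  obtain ⟨d, hd⟩ := h2
  have hc' : (t' + c * s' - t) • a + c • b = 0 := by
    have := sub_eq_zero.2 hc
    rw [← this]
    module
  have hd' : (t' + d * s' - t - s) • a + (d - 1) • b = 0 := by
    have := sub_eq_zero.2 hd
    rw [← this]
    module
  obtain ⟨h3, h4⟩ := h _ _ hc'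
  obtain ⟨h5, h6⟩ := h _ _ hd'
  rw [h4] at h3
  have h7 : d = 1 := sub_eq_zero.1 h6
  rw [h7] at h5
  have h8 : t = t' := by linear_combination -h3
  exact ⟨h8, by linear_combination -h5 - h8⟩

theorem zero_mem_line_smul_add {a b : V} (h : LinearIndependent F ![a, b]) {t s : F}
    (h0 : (0 : V) ∈ line F (t • a) (b + s • a)) : t = 0 := by
  rw [LinearIndependent.pair_iff] at h
  obtain ⟨c, hc⟩ := h0
  have hc' : (t + c * s) • a + c • b = 0 := by
    rw [← hc]
    module
  obtain ⟨h3, h4⟩ := h _ _ hc'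
  rw [h4] at h3
  linear_combination h3

theorem add_smul_ne_zero {a b : V} (h : LinearIndependent F ![a, b]) (s : F) :
    b + s • a ≠ 0 := by
  intro h0
  have := (LinearIndependent.pair_iff.1 h s 1 (by rw [← h0]; module)).2
  exact one_ne_zero this

end Basics

/-! ### Lines over a finite field. -/

section Finite

variable {F V : Type*} [Field F] [Fintype F] [AddCommGroup V] [Module F V]

theorem ncard_line (x : V) {v : V} (hv : v ≠ 0) : (line F x v).ncard = Fintype.card F := by
  unfold line
  rw [← Set.image_univ, Set.ncard_image_of_injective, Set.ncard_univ, Nat.card_eq_fintype_card]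
  intro s t hst
  exact smul_left_injective F hv (by simpa using hst)

theorem finite_line (x v : V) : (line F x v).Finite := Set.finite_range _

theorem IsLine.finite {L : Set V} (hL : IsLine F L) : L.Finite := by
  obtain ⟨x, v, hv, rfl⟩ := hL
  exact finite_line x v

theorem IsLine.ncard {L : Set V} (hL : IsLine F L) : L.ncard = Fintype.card F := by
  obtain ⟨x, v, hv, rfl⟩ := hL
  exact ncard_line x hv

/-- All lines are finite of the same size, so an inclusion between a line and the image of a line is
an equality. -/
theorem IsLine.image_isLine_of_line_subset {L : Set V} (hL : IsLine F L) (f : Equiv.Perm V)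
    {M : Set V} (hM : IsLine F M) (h : M ⊆ f '' L) : IsLine F (f '' L) := by
  have : M = f '' L := by
    apply Set.eq_of_subset_of_ncard_le h _ (hL.finite.image f)
    rw [Set.ncard_image_of_injective _ f.injective, hL.ncard, hM.ncard]
  rwa [← this]

theorem IsLine.image_isLine_of_subset_line {L : Set V} (hL : IsLine F L) (f : Equiv.Perm V)
    {M : Set V} (hM : IsLine F M) (h : f '' L ⊆ M) : IsLine F (f '' L) := by
  have : f '' L = M := by
    apply Set.eq_of_subset_of_ncard_le h _ hM.finite
    rw [Set.ncard_image_of_injective _ f.injective, hL.ncard, hM.ncard]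
  rwa [this]

theorem exists_ne_zero_ne (hq : 3 ≤ Fintype.card F) (a : F) : ∃ c : F, c ≠ 0 ∧ c ≠ a := by
  by_contra! h
  have : (Finset.univ : Finset F) ⊆ {0, a} := by
    intro c _
    by_cases hc : c = 0
    · simp [hc]
    · simp [h c hc]
  have h1 := Finset.card_le_card this
  have h2 := Finset.card_le_two (a := (0 : F)) (b := a)
  rw [Finset.card_univ] at h1
  omega

end Finite

/-! ### Good lines through the origin and their consequences. -/

section Good

variable {F V : Type*} [Field F] [AddCommGroup V] [Module F V] {f : Equiv.Perm V}

theorem image_line_zero (h0 : f 0 = 0) {v : V} (hv : v ≠ 0)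
    (hg : IsLine F (f '' line F 0 v)) : f '' line F 0 v = line F 0 (f v) := by
  apply hg.eq_line_zero ⟨0, left_mem_line _ _, h0⟩
  · exact ⟨v, by simpa using add_mem_line (F := F) 0 v, rfl⟩
  · intro h
    exact hv (f.injective (h.trans h0.symm))

theorem apply_ne_zero (h0 : f 0 = 0) {v : V} (hv : v ≠ 0) : f v ≠ 0 := fun h =>
  hv (f.injective (h.trans h0.symm))

/-- Only the line of `u` has to be good: its image is then the whole line of `f u`, and `f w` misses
it by injectivity. -/
theorem indep_image (h0 : f 0 = 0) {u w : V} (h : LinearIndependent F ![u, w])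
    (hg : IsLine F (f '' line F 0 u)) : LinearIndependent F ![f u, f w] := by
  have hu : u ≠ 0 := indep_left_ne_zero h
  rw [indep_iff hu] at h
  rw [indep_iff (apply_ne_zero h0 hu), ← image_line_zero h0 hu hg]
  rintro ⟨z, hz, hzw⟩
  rw [f.injective hzw] at hz
  exact h hz

theorem apply_smul_mem (h0 : f 0 = 0) {v : V} (hv : v ≠ 0)
    (hg : IsLine F (f '' line F 0 v)) (t : F) : f (t • v) ∈ line F 0 (f v) := by
  rw [← image_line_zero h0 hv hg]
  exact ⟨_, ⟨t, by simp⟩, rfl⟩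

theorem apply_smul_mem_submodule (h0 : f 0 = 0) {v : V} (hv : v ≠ 0)
    (hg : IsLine F (f '' line F 0 v)) {Q : Submodule F V} (hQ : f v ∈ Q) (t : F) :
    f (t • v) ∈ Q := by
  obtain ⟨s, hs⟩ := mem_line_zero.1 (apply_smul_mem h0 hv hg t)
  rw [← hs]
  exact Q.smul_mem _ hQ

/-- Disjoint lines in a plane are parallel. -/
theorem parallel_of_disjoint {Q : Submodule F V} (hQ : Module.finrank F Q = 2) {x y v w : V}
    (hx : x ∈ Q) (hy : y ∈ Q) (hv : v ∈ Q) (hw : w ∈ Q) (hv0 : v ≠ 0)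
    (h : Disjoint (line F x v) (line F y w)) : w ∈ line F 0 v := by
  by_contra hn
  obtain ⟨a, b, hab⟩ := indep_mem_combo hQ hv hw ((indep_iff hv0).2 hn) (Q.sub_mem hy hx)
  refine Set.disjoint_left.1 h (show x + a • v ∈ _ from ⟨a, rfl⟩) ⟨-b, ?_⟩
  have : y = x + (a • v + b • w) := by rw [hab]; abel
  simp only
  rw [this]
  module

/-- If all lines of a plane parallel to `line F 0 a` but this one have images that are lines, and
the image of the plane is a plane, then the image of `line F 0 a` is also a line. -/
theorem good_of_parallels [Fintype F] (h0 : f 0 = 0) {P Q : Submodule F V}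
    (hP : Module.finrank F P = 2) (hQ : Module.finrank F Q = 2) (hPQ : f '' P = (Q : Set V))
    {a b : V} (ha : a ∈ P) (hb : b ∈ P) (hab : LinearIndependent F ![a, b])
    (hg : ∀ t : F, t ≠ 0 → IsLine F (f '' line F (t • b) a)) :
    IsLine F (f '' line F 0 a) := by
  have ha0 : a ≠ 0 := indep_left_ne_zero hab
  have hfP : ∀ z ∈ P, f z ∈ Q := fun z hz => by
    have : f z ∈ f '' (P : Set V) := ⟨z, hz, rfl⟩
    rwa [hPQ] at this
  have hdir : ∀ t : F, t ≠ 0 → ∃ v ∈ Q, v ≠ 0 ∧ f '' line F (t • b) a = line F (f (t • b)) v := by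
    intro t ht
    have hx : f (t • b) ∈ f '' line F (t • b) a := ⟨_, left_mem_line _ _, rfl⟩
    obtain ⟨v, hv, he⟩ := (hg t ht).exists_eq hx
    refine ⟨v, ?_, hv, he⟩
    have h1 : f (t • b) + v ∈ f '' line F (t • b) a := he ▸ add_mem_line _ _
    obtain ⟨z, hz, hzv⟩ := h1
    have h2 := hfP z (line_subset_submodule (P.smul_mem _ hb) ha hz)
    rw [hzv] at h2
    have := Q.sub_mem h2 (hfP _ (P.smul_mem t hb))
    simpa using this
  have hdisj : ∀ s t : F, s ≠ t → Disjoint (line F (s • b) a) (line F (t • b) a) := by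
    intro s t hst
    rw [Set.disjoint_left]
    rintro _ ⟨c, rfl⟩ ⟨d, hd⟩
    have : (d - c) • a + (t - s) • b = 0 := by
      have := sub_eq_zero.2 hd
      rw [← this]
      module
    have := (LinearIndependent.pair_iff.1 hab _ _ this).2
    exact hst (sub_eq_zero.1 this).symm
  -- The image of the parallel through `b` provides a direction `w`. The images of the other
  -- parallels are lines of `Q` disjoint from it, hence have the same direction.
  obtain ⟨w, hwQ, hw0, hw⟩ := hdir 1 one_ne_zero
  have hdir' : ∀ t : F, t ≠ 0 → ∀ z ∈ f '' line F (t • b) a, ∀ c : F,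
      z + c • w ∈ f '' line F (t • b) a := by
    intro t ht z hz c
    obtain ⟨v, hvQ, hv0, hv⟩ := hdir t ht
    have : line F (f (t • b)) v = line F (f (t • b)) w := by
      by_cases h1 : t = 1
      · subst h1
        rw [← hw, hv]
      · have : w ∈ line F 0 v := by
          refine parallel_of_disjoint hQ (x := f (t • b)) (y := f ((1 : F) • b))
            (hfP _ (P.smul_mem _ hb)) (hfP _ (P.smul_mem _ hb)) hvQ hwQ hv0 ?_
          rw [← hv, ← hw]
          exact (Set.disjoint_image_iff f.injective).2 (hdisj t 1 h1)
        obtain ⟨c, hc⟩ := mem_line_zero.1 this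
        rw [← hc, line_smul]
        rintro rfl
        simp at hc
        exact hw0 hc.symm
    rw [hv, this] at hz ⊢
    obtain ⟨d, rfl⟩ := hz
    exact ⟨d + c, by module⟩
  apply (isLine_line 0 ha0).image_isLine_of_line_subset f (isLine_line 0 hw0)
  rintro _ ⟨c, rfl⟩
  -- Every point of the line of `w` has a preimage in `P`. If that preimage lay off the line of `a`,
  -- the image of its parallel, being closed under translation along `w`, would contain 0.
  have hcw : 0 + c • w ∈ (Q : Set V) := by simpa using Q.smul_mem c hwQ
  rw [← hPQ] at hcw
  obtain ⟨z, hzP, hz⟩ := hcw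
  obtain ⟨s, t, rfl⟩ := indep_mem_combo hP ha hb hab hzP
  by_cases ht : t = 0
  · subst ht
    exact ⟨_, ⟨s, by simp⟩, hz⟩
  · exfalso
    have h1 : f (s • a + t • b) ∈ f '' line F (t • b) a := ⟨_, ⟨s, by simp [add_comm]⟩, rfl⟩
    have h2 := hdir' t ht _ h1 (-c)
    rw [hz] at h2
    have h3 : (0 + c • w + -c • w) = f 0 := by rw [h0]; module
    rw [h3] at h2
    obtain ⟨y, hy, hy0⟩ := h2
    rw [f.injective hy0] at hy
    have := hdisj t 0 ht
    rw [zero_smul] at this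
    exact Set.disjoint_left.1 this hy (left_mem_line _ _)

/-- If lines through `0` and outside `A` in `U` are good, then `f '' A` is closed under scalars. -/
theorem smul_mem_image {U U' : Submodule F V} (h0 : f 0 = 0) (hU : f '' U = (U' : Set V))
    {A : Set V} (hA : A ⊆ U) (hA0 : ∀ z ∈ A, line F 0 z ⊆ A)
    (hg : ∀ z ∈ U, z ∉ A → IsLine F (f '' line F 0 z)) (y : V) (hy : y ∈ f '' A) (t : F)
    (h0A : 0 ∈ A) : t • y ∈ f '' A := by
  by_cases hty : t • y = 0
  · rw [hty]
    exact ⟨0, h0A, h0⟩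
  have hyU : y ∈ U' := by
    have := Set.image_mono hA hy
    rwa [hU] at this
  have htU : t • y ∈ (U' : Set V) := U'.smul_mem t hyU
  rw [← hU] at htU
  obtain ⟨z, hzU, hz⟩ := htU
  -- Otherwise `t • y` comes from some `z` outside `A`. The good line of `z` is mapped onto the line
  -- of `t • y`, which contains `y`; so the line of `z` meets `A` off 0 and is contained in `A`.
  by_contra hn
  have hzA : z ∉ A := fun h => hn ⟨z, h, hz⟩
  have hz0 : z ≠ 0 := fun h => hzA (h ▸ h0A)
  have h1 := image_line_zero h0 hz0 (hg z hzU hzA)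
  have ht : t ≠ 0 := by
    rintro rfl
    simp at hty
  have h2 : y ∈ f '' line F 0 z := by
    rw [h1, hz]
    exact mem_line_zero.2 ⟨t⁻¹, by simp [smul_smul, ht]⟩
  obtain ⟨x, hx, rfl⟩ := h2
  obtain ⟨x', hx', hxx⟩ := hy
  rw [f.injective hxx] at hx'
  have hx0 : x ≠ 0 := by
    rintro rfl
    simp [h0] at hty
  have := hA0 x hx'
  rw [← line_zero_eq_of_mem hx hx0] at this
  exact hzA (this (by simpa using add_mem_line (F := F) 0 z))

/-- A permutation cannot send to lines all lines through the origin but one. -/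
theorem good_of_all_others_good [Fintype F] {U U' : Submodule F V} (h0 : f 0 = 0)
    (hU : f '' U = (U' : Set V)) {a : V} (ha : a ∈ U) (ha0 : a ≠ 0)
    (hg : ∀ z ∈ U, z ∉ line F 0 a → IsLine F (f '' line F 0 z)) :
    IsLine F (f '' line F 0 a) := by
  apply (isLine_line 0 ha0).image_isLine_of_line_subset f (isLine_line 0 (apply_ne_zero h0 ha0))
  rintro _ ⟨t, rfl⟩
  simp only [zero_add]
  refine smul_mem_image h0 hU (line_subset_submodule U.zero_mem ha) ?_ hg _ ?_ t
    (left_mem_line _ _)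
  · rintro z hz _ ⟨c, rfl⟩
    simpa using smul_mem_line_zero hz c
  · exact ⟨a, by simpa using add_mem_line (F := F) 0 a, rfl⟩

/-- A line whose image lies in the union of two lines through the origin, but is not a line,
has a nonzero point mapped into each of the two lines. -/
theorem exists_apply_mem [Fintype F] (h0 : f 0 = 0) {a a' b' : V} (ha0 : a ≠ 0) (hb' : b' ≠ 0)
    (hA : ¬ IsLine F (f '' line F 0 a))
    (h : ∀ z ∈ line F 0 a, f z ∈ line F 0 a' ∪ line F 0 b') :
    ∃ x ∈ line F 0 a, x ≠ 0 ∧ f x ∈ line F 0 a' := by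
  have hA' : ¬ f '' line F 0 a ⊆ line F 0 b' := fun h =>
    hA ((isLine_line 0 ha0).image_isLine_of_subset_line f (isLine_line 0 hb') h)
  rw [Set.not_subset] at hA'
  obtain ⟨_, ⟨x, hx, rfl⟩, hxb⟩ := hA'
  refine ⟨x, hx, ?_, (h x hx).resolve_right hxb⟩
  rintro rfl
  rw [h0] at hxb
  exact hxb (left_mem_line _ _)

end Good

/-! ### Bad lines, and planes with two bad lines through the origin. -/

section Counting

variable {F V : Type*} [Field F] [AddCommGroup V] [Module F V] [Fintype V]

variable (F) in
/-- The lines in `U` whose images under `f` are not lines. -/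
noncomputable def badLines (f : Equiv.Perm V) (U : Set V) : Finset (Set V) :=
  Finset.univ.filter fun L => IsLine F L ∧ L ⊆ U ∧ ¬ IsLine F (f '' L)

variable (F) in
/-- The lines in `U` through the origin whose images under `f` are not lines. -/
noncomputable def badLinesThrough (f : Equiv.Perm V) (U : Set V) : Finset (Set V) :=
  (badLines F f U).filter fun L => (0 : V) ∈ L

variable (F) in
/-- The lines in `U` not through the origin whose images under `f` are not lines. -/
noncomputable def badLinesOff (f : Equiv.Perm V) (U : Set V) : Finset (Set V) :=
  (badLines F f U).filter fun L => (0 : V) ∉ L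

theorem mem_badLines {f : Equiv.Perm V} {U : Set V} {L : Set V} :
    L ∈ badLines F f U ↔ IsLine F L ∧ L ⊆ U ∧ ¬ IsLine F (f '' L) := by
  simp [badLines]

theorem mem_badLinesThrough {f : Equiv.Perm V} {U : Set V} {L : Set V} :
    L ∈ badLinesThrough F f U ↔ (IsLine F L ∧ L ⊆ U ∧ ¬ IsLine F (f '' L)) ∧ (0 : V) ∈ L := by
  simp [badLinesThrough, mem_badLines]

theorem mem_badLinesOff {f : Equiv.Perm V} {U : Set V} {L : Set V} :
    L ∈ badLinesOff F f U ↔ (IsLine F L ∧ L ⊆ U ∧ ¬ IsLine F (f '' L)) ∧ (0 : V) ∉ L := by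
  simp [badLinesOff, mem_badLines]

theorem card_badLines (f : Equiv.Perm V) (U : Set V) :
    (badLines F f U).card = (badLinesThrough F f U).card + (badLinesOff F f U).card :=
  (Finset.card_filter_add_card_filter_not _).symm

theorem image_eq_of_image_subset {P Q : Submodule F V} {f : Equiv.Perm V}
    (hP : Module.finrank F P = 2) (hQ : Module.finrank F Q = 2) (h : ∀ z ∈ P, f z ∈ Q) :
    f '' P = (Q : Set V) := by
  apply Set.eq_of_subset_of_ncard_le _ _ (Set.toFinite _)
  · rintro _ ⟨z, hz, rfl⟩
    exact h z hz
  · rw [Set.ncard_image_of_injective _ f.injective]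
    have h1 := Module.natCard_eq_pow_finrank (K := F) (V := P)
    have h2 := Module.natCard_eq_pow_finrank (K := F) (V := Q)
    rw [hP] at h1
    rw [hQ, ← h1] at h2
    exact le_of_eq h2

variable [Fintype F]

theorem card_filter_mem_line (x : V) {v : V} (hv : v ≠ 0) :
    (Finset.univ.filter fun z => z ∈ line F x v).card = Fintype.card F := by
  rw [← ncard_line x hv, Set.ncard_eq_toFinset_card']
  congr 1
  ext z
  simp

theorem card_filter_mem_line_zero {v : V} (hv : v ≠ 0) :
    (Finset.univ.filter fun z => z ∈ line F 0 v ∧ z ≠ 0).card + 1 = Fintype.card F := by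
  rw [← card_filter_mem_line 0 hv]
  have : (Finset.univ.filter fun z => z ∈ line F 0 v ∧ z ≠ 0) =
      (Finset.univ.filter fun z => z ∈ line F 0 v).erase 0 := by
    ext z
    simp [and_comm]
  rw [this, Finset.card_erase_add_one]
  simp [left_mem_line]

theorem card_plane {P : Submodule F V} (hP : Module.finrank F P = 2) :
    (Finset.univ.filter fun z => z ∈ P).card = Fintype.card F ^ 2 := by
  have h := Module.card_eq_pow_finrank (K := F) (V := P)
  rw [hP, Fintype.card_subtype] at h
  exact h

variable {f : Equiv.Perm V}

/-- If all lines through the origin but two have images that are lines, then the union of these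
two lines is mapped onto the union of two lines. -/
theorem exists_image_union_eq {U U' : Submodule F V} (h0 : f 0 = 0)
    (hU : f '' U = (U' : Set V)) {a b : V} (ha : a ∈ U) (hb : b ∈ U)
    (hab : LinearIndependent F ![a, b]) (hA : ¬ IsLine F (f '' line F 0 a))
    (hg : ∀ z ∈ U, z ∉ line F 0 a → z ∉ line F 0 b → IsLine F (f '' line F 0 z)) :
    ∃ a' b' : V, LinearIndependent F ![a', b'] ∧
      f '' (line F 0 a ∪ line F 0 b) = line F 0 a' ∪ line F 0 b' := by
  have ha0 : a ≠ 0 := indep_left_ne_zero hab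
  have hb0 : b ≠ 0 := indep_right_ne_zero hab
  -- The image of a bad line is not contained in a line, so it provides a second direction `f x`.
  have hA' : ¬ f '' line F 0 a ⊆ line F 0 (f a) := fun h =>
    hA ((isLine_line 0 ha0).image_isLine_of_subset_line f
      (isLine_line 0 (apply_ne_zero h0 ha0)) h)
  rw [Set.not_subset] at hA'
  obtain ⟨_, ⟨x, hx, rfl⟩, hxa⟩ := hA'
  have hclosed : ∀ y ∈ f '' (line F 0 a ∪ line F 0 b), ∀ t : F,
      t • y ∈ f '' (line F 0 a ∪ line F 0 b) := by
    intro y hy t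
    refine smul_mem_image h0 hU (Set.union_subset (line_subset_submodule U.zero_mem ha)
      (line_subset_submodule U.zero_mem hb)) ?_ ?_ y hy t (Or.inl (left_mem_line _ _))
    · rintro z (hz | hz) _ ⟨c, rfl⟩
      · left; simpa using smul_mem_line_zero hz c
      · right; simpa using smul_mem_line_zero hz c
    · intro z hzU hz
      exact hg z hzU (fun h => hz (Or.inl h)) (fun h => hz (Or.inr h))
  have hind : LinearIndependent F ![f a, f x] := (indep_iff (apply_ne_zero h0 ha0)).2 hxa
  refine ⟨f a, f x, hind, ?_⟩
  symm
  have hinter : ∀ u w : V, LinearIndependent F ![u, w] →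
      (line F 0 u ∪ line F 0 w).ncard + 1 = Fintype.card F + Fintype.card F := by
    intro u w huw
    have h1 := Set.ncard_union_add_ncard_inter (line F 0 u) (line F 0 w) (finite_line _ _)
      (finite_line _ _)
    have h2 : line F 0 u ∩ line F 0 w = {0} := by
      refine Set.eq_singleton_iff_unique_mem.2 ⟨⟨left_mem_line _ _, left_mem_line _ _⟩, ?_⟩
      rintro z ⟨hz1, hz2⟩
      exact eq_zero_of_mem_of_mem huw hz1 hz2
    rw [h2, Set.ncard_singleton, ncard_line _ (indep_left_ne_zero huw), ncard_line _ (indep_right_ne_zero huw)] at h1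
    exact h1
  -- Both sides have 2q - 1 points, so the inclusion given by closure under scalars is enough.
  apply Set.eq_of_subset_of_ncard_le _ _ (Set.toFinite _)
  · rintro z (hz | hz)
    · obtain ⟨t, rfl⟩ := mem_line_zero.1 hz
      exact hclosed _ ⟨a, Or.inl (by simpa using add_mem_line (F := F) 0 a), rfl⟩ t
    · obtain ⟨t, rfl⟩ := mem_line_zero.1 hz
      exact hclosed _ ⟨x, Or.inl hx, rfl⟩ t
  · rw [Set.ncard_image_of_injective _ f.injective]
    have h1 := hinter a b hab
    have h2 := hinter _ _ hind
    omega

/-- If two lines through the origin in a plane are the only ones in it whose images are not lines,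
then also some other line parallel to the first one has an image that is not a line. -/
theorem exists_parallel_bad (hq : 3 ≤ Fintype.card F) {P : Submodule F V} (h0 : f 0 = 0)
    (hP : Module.finrank F P = 2) {a b a' b' : V} (ha : a ∈ P) (hb : b ∈ P)
    (hab : LinearIndependent F ![a, b]) (hA : ¬ IsLine F (f '' line F 0 a))
    (hB : ¬ IsLine F (f '' line F 0 b))
    (hg : ∀ z ∈ P, z ∉ line F 0 a → z ∉ line F 0 b → IsLine F (f '' line F 0 z))
    (hab' : LinearIndependent F ![a', b'])
    (him : f '' (line F 0 a ∪ line F 0 b) = line F 0 a' ∪ line F 0 b') :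
    ∃ t : F, t ≠ 0 ∧ ¬ IsLine F (f '' line F (t • b) a) := by
  by_contra! hpar
  have ha0 : a ≠ 0 := indep_left_ne_zero hab
  have hb0 : b ≠ 0 := indep_right_ne_zero hab
  have hpi := LinearIndependent.pair_iff.1 hab
  -- Since q ≥ 3, two lines through 0, spanned by `a + b` and `a + c • b`, are distinct from the two
  -- bad ones. Every parallel to `a` off 0 crosses both, so its image lies in the plane `Q` spanned
  -- by their images.
  obtain ⟨c, hc0, hc1⟩ := exists_ne_zero_ne hq (1 : F)
  have hm : ∀ c : F, c ≠ 0 → a + c • b ≠ 0 ∧ IsLine F (f '' line F 0 (a + c • b)) := by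
    intro c hc
    constructor
    · intro h
      have := hpi 1 c (by simpa using h)
      simp at this
    · apply hg _ (P.add_mem ha (P.smul_mem c hb))
      · intro h
        obtain ⟨t, ht⟩ := mem_line_zero.1 h
        have := hpi (1 - t) c (by
          have := sub_eq_zero.2 ht.symm
          rw [← this]; module)
        exact hc this.2
      · intro h
        obtain ⟨t, ht⟩ := mem_line_zero.1 h
        have := hpi 1 (c - t) (by
          have := sub_eq_zero.2 ht.symm
          rw [← this]; module)
        simp at this
  have hind : LinearIndependent F ![a + (1 : F) • b, a + c • b] := by
    rw [LinearIndependent.pair_iff]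
    intro s t hst
    obtain ⟨h1, h2⟩ := hpi (s + t) (s + t * c) (by rw [← hst]; module)
    have h3 : t * (c - 1) = 0 := by linear_combination h2 - h1
    rcases mul_eq_zero.1 h3 with h3 | h3
    · exact ⟨by rw [h3] at h1; simpa using h1, h3⟩
    · exact absurd (sub_eq_zero.1 h3) hc1
  have hind' := indep_image h0 hind (hm 1 one_ne_zero).2
  set Q := Submodule.span F {f (a + (1 : F) • b), f (a + c • b)} with hQdef
  have hQ : Module.finrank F Q = 2 := finrank_span_pair hind'
  have hlQ : ∀ t : F, t ≠ 0 → f '' line F (t • b) a ⊆ Q := by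
    intro t ht
    have h1 : t • (a + (1 : F) • b) ∈ line F (t • b) a := ⟨t, by module⟩
    have h2 : (t / c) • (a + c • b) ∈ line F (t • b) a := ⟨t / c, by
      rw [smul_add, smul_smul, div_mul_cancel₀ _ hc0, add_comm]⟩
    refine (hpar t ht).subset_submodule (x := f (t • (a + (1 : F) • b)))
      (y := f ((t / c) • (a + c • b))) ?_ ⟨_, h1, rfl⟩ ⟨_, h2, rfl⟩ ?_ ?_
    · intro he
      have he := f.injective he
      have := (LinearIndependent.pair_iff.1 hind t (-(t / c)) (by
        rw [neg_smul, ← sub_eq_add_neg, sub_eq_zero]; exact he)).1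
      exact ht this
    · exact apply_smul_mem_submodule h0 (hm 1 one_ne_zero).1 (hm 1 one_ne_zero).2
        (Submodule.subset_span (by simp)) t
    · exact apply_smul_mem_submodule h0 (hm c hc0).1 (hm c hc0).2
        (Submodule.subset_span (by simp)) _
  have hBQ : ∀ y ∈ line F 0 b, y ≠ 0 → f y ∈ Q := by
    intro y hy hy0
    obtain ⟨t, rfl⟩ := mem_line_zero.1 hy
    have ht : t ≠ 0 := by
      rintro rfl
      simp at hy0
    exact hlQ t ht ⟨_, left_mem_line _ _, rfl⟩
  have himB : ∀ z ∈ line F 0 b, f z ∈ line F 0 a' ∪ line F 0 b' := fun z hz =>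
    him ▸ ⟨z, Or.inr hz, rfl⟩
  -- The image of the bad line of `b` has a nonzero point on each of the two image lines, and these
  -- points lie in `Q`. So `Q` also contains the image of the line of `a`, and `f` maps `P` onto
  -- `Q`.
  have hunion : line F 0 a' ∪ line F 0 b' ⊆ Q := by
    obtain ⟨x, hx, hx0, hxa⟩ := exists_apply_mem h0 hb0 (indep_right_ne_zero hab') hB himB
    obtain ⟨y, hy, hy0, hyb⟩ := exists_apply_mem h0 hb0 (indep_left_ne_zero hab') hB
      (fun z hz => (himB z hz).symm)
    rw [line_zero_eq_of_mem hxa (apply_ne_zero h0 hx0),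
      line_zero_eq_of_mem hyb (apply_ne_zero h0 hy0)]
    exact Set.union_subset (line_subset_submodule Q.zero_mem (hBQ x hx hx0))
      (line_subset_submodule Q.zero_mem (hBQ y hy hy0))
  refine hA (good_of_parallels h0 hP hQ (image_eq_of_image_subset hP hQ ?_) ha hb hab hpar)
  intro z hz
  obtain ⟨s, t, rfl⟩ := indep_mem_combo hP ha hb hab hz
  by_cases ht : t = 0
  · apply hunion
    rw [← him]
    exact ⟨_, Or.inl ⟨s, by simp [ht]⟩, rfl⟩
  · exact hlQ t ht ⟨_, ⟨s, by simp [add_comm]⟩, rfl⟩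

/-- If exactly two lines through the origin in a plane have images that are not lines, then so do
at least `2 (q - 1)` of the other lines in this plane. -/
theorem card_badLinesOff_of_two_bad (hq : 3 ≤ Fintype.card F) {P : Submodule F V} (h0 : f 0 = 0)
    (hP : Module.finrank F P = 2) {a b a' b' : V} (ha : a ∈ P) (hb : b ∈ P)
    (hab : LinearIndependent F ![a, b]) (hA : ¬ IsLine F (f '' line F 0 a))
    (hB : ¬ IsLine F (f '' line F 0 b))
    (hg : ∀ z ∈ P, z ∉ line F 0 a → z ∉ line F 0 b → IsLine F (f '' line F 0 z))
    (hab' : LinearIndependent F ![a', b'])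
    (him : f '' (line F 0 a ∪ line F 0 b) = line F 0 a' ∪ line F 0 b') :
    2 * Fintype.card F ≤ (badLinesOff F f P).card + 2 := by
  have ha0 : a ≠ 0 := indep_left_ne_zero hab
  have hb0 : b ≠ 0 := indep_right_ne_zero hab
  have ha0' : a' ≠ 0 := indep_left_ne_zero hab'
  have hb0' : b' ≠ 0 := indep_right_ne_zero hab'
  obtain ⟨s, hs0, hs⟩ := exists_parallel_bad hq h0 hP ha hb hab hA hB hg hab' him
  obtain ⟨t, ht0, ht⟩ := exists_parallel_bad hq h0 hP hb ha (indep_symm hab) hB hA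
    (fun z hz h1 h2 => hg z hz h2 h1) hab' (by rw [Set.union_comm, him])
  have himA : ∀ z ∈ line F 0 a, f z ∈ line F 0 a' ∪ line F 0 b' := fun z hz =>
    him ▸ ⟨z, Or.inl hz, rfl⟩
  obtain ⟨x₁, hx₁, hx₁0, hx₁a⟩ := exists_apply_mem h0 ha0 hb0' hA himA
  obtain ⟨x₂, hx₂, hx₂0, hx₂b⟩ := exists_apply_mem h0 ha0 ha0' hA
    (fun z hz => (himA z hz).symm)
  let S : V → V → Finset V := fun u u' => Finset.univ.filter fun x =>
    (x ∈ line F 0 u ∧ x ≠ 0) ∧ f x ∈ line F 0 u'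
  have hS : ∀ u u' x, x ∈ S u u' ↔ (x ∈ line F 0 u ∧ x ≠ 0) ∧ f x ∈ line F 0 u' := by
    intro u u' x
    simp [S]
  have hcardA : (S a a').card + (S a b').card + 1 = Fintype.card F := by
    rw [← card_filter_mem_line_zero (F := F) ha0, ← Finset.card_union_of_disjoint]
    · congr 2
      ext x
      simp only [Finset.mem_union, hS, Finset.mem_filter, Finset.mem_univ, true_and]
      constructor
      · rintro (h | h) <;> exact h.1
      · intro h
        rcases himA x h.1 with h1 | h1
        · exact Or.inl ⟨h, h1⟩
        · exact Or.inr ⟨h, h1⟩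
    · rw [Finset.disjoint_left]
      intro x h1 h2
      rw [hS] at h1 h2
      exact apply_ne_zero h0 h1.1.2 (eq_zero_of_mem_of_mem hab' h1.2 h2.2)
  have hcard' : ∀ u' : V, u' ≠ 0 → line F 0 u' ⊆ line F 0 a' ∪ line F 0 b' →
      (S a u').card + (S b u').card + 1 = Fintype.card F := by
    intro u' hu' hsub
    rw [← card_filter_mem_line_zero (F := F) hu', ← Finset.card_union_of_disjoint]
    · congr 1
      rw [← Finset.card_map f.toEmbedding]
      congr 1
      ext y
      simp only [Finset.mem_map, Finset.mem_union, hS, Finset.mem_filter, Finset.mem_univ,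
        true_and, Equiv.coe_toEmbedding]
      constructor
      · rintro ⟨x, (h | h), rfl⟩ <;> exact ⟨h.2, apply_ne_zero h0 h.1.2⟩
      · rintro ⟨hy, hy0⟩
        have := hsub hy
        rw [← him] at this
        obtain ⟨x, hx, rfl⟩ := this
        have hx0 : x ≠ 0 := by
          rintro rfl
          exact hy0 h0
        refine ⟨x, ?_, rfl⟩
        rcases hx with hx | hx
        · exact Or.inl ⟨⟨hx, hx0⟩, hy⟩
        · exact Or.inr ⟨⟨hx, hx0⟩, hy⟩
    · rw [Finset.disjoint_left]
      intro x h1 h2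
      rw [hS] at h1 h2
      exact h1.1.2 (eq_zero_of_mem_of_mem hab h1.1.1 h2.1.1)
  have hc1 := hcard' a' ha0' Set.subset_union_left
  have hc2 := hcard' b' hb0' Set.subset_union_right
  have hpos1 : 1 ≤ (S a a').card := Finset.card_pos.2 ⟨x₁, (hS _ _ _).2 ⟨⟨hx₁, hx₁0⟩, hx₁a⟩⟩
  have hpos2 : 1 ≤ (S a b').card := Finset.card_pos.2 ⟨x₂, (hS _ _ _).2 ⟨⟨hx₂, hx₂0⟩, hx₂b⟩⟩
  -- These are pairs of points, one on each bad line, whose images lie on a common line through 0.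
  -- If the line joining them were good, its image would be that line and contain 0, although the
  -- joining line misses 0.
  let T : Finset (V × V) := (S a a' ×ˢ S b a') ∪ (S a b' ×ˢ S b b')
  have hT : ∀ p ∈ T, (p.1 ∈ line F 0 a ∧ p.1 ≠ 0) ∧ (p.2 ∈ line F 0 b ∧ p.2 ≠ 0) ∧
      ∃ u' : V, f p.1 ∈ line F 0 u' ∧ f p.2 ∈ line F 0 u' := by
    intro p hp
    simp only [T, Finset.mem_union, Finset.mem_product, hS] at hp
    rcases hp with hp | hp
    · exact ⟨hp.1.1, hp.2.1, a', hp.1.2, hp.2.2⟩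
    · exact ⟨hp.1.1, hp.2.1, b', hp.1.2, hp.2.2⟩
  have hTcard : T.card = (S a a').card * (S b a').card + (S a b').card * (S b b').card := by
    rw [Finset.card_union_of_disjoint, Finset.card_product, Finset.card_product]
    rw [Finset.disjoint_left]
    intro p h1 h2
    simp only [Finset.mem_product, hS] at h1 h2
    exact apply_ne_zero h0 h1.1.1.2 (eq_zero_of_mem_of_mem hab' h1.1.2 h2.1.2)
  have hneT : ∀ p ∈ T, p.2 - p.1 ≠ 0 := by
    intro p hp h
    obtain ⟨h1, h2, -⟩ := hT p hp
    rw [sub_eq_zero] at h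
    exact h1.2 (eq_zero_of_mem_of_mem hab h1.1 (h ▸ h2.1))
  let j : V × V → Set V := fun p => line F p.1 (p.2 - p.1)
  have hj1 : ∀ p, p.1 ∈ j p := fun p => left_mem_line _ _
  have hj2 : ∀ p, p.2 ∈ j p := fun p => by simpa using add_mem_line (F := F) p.1 (p.2 - p.1)
  have hjl : ∀ p ∈ T, IsLine F (j p) := fun p hp => isLine_line _ (hneT p hp)
  have hj0 : ∀ p ∈ T, (0 : V) ∉ j p := by
    intro p hp h
    obtain ⟨h1, h2, -⟩ := hT p hp
    have e1 := (hjl p hp).eq_line_zero h (hj1 p) h1.2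
    have e2 := (hjl p hp).eq_line_zero h (hj2 p) h2.2
    have := (line_zero_eq_of_mem h1.1 h1.2).trans (e1.symm.trans e2)
    refine h2.2 (eq_zero_of_mem_of_mem hab ?_ h2.1)
    rw [this]
    exact mem_line_zero_self _
  have huniq : ∀ p ∈ T, ∀ u : V, u ≠ 0 → ∀ x ∈ line F 0 u, ∀ y ∈ line F 0 u, x ∈ j p → y ∈ j p →
      x = y := by
    intro p hp u hu x hx y hy hxp hyp
    by_contra hxy
    have := (hjl p hp).eq_of_mem (isLine_line 0 hu) hxy hxp hyp hx hy
    exact hj0 p hp (this ▸ left_mem_line _ _)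
  have hinj : Set.InjOn j T := by
    intro p hp r hr hpr
    have h1 := hT p hp
    have h2 := hT r hr
    have e1 : p.1 = r.1 := huniq p hp a ha0 _ h1.1.1 _ h2.1.1 (hj1 p) (hpr ▸ hj1 r)
    have e2 : p.2 = r.2 := huniq p hp b hb0 _ h1.2.1.1 _ h2.2.1.1 (hj2 p) (hpr ▸ hj2 r)
    exact Prod.ext e1 e2
  have hjbad : ∀ p ∈ T, ¬ IsLine F (f '' j p) := by
    intro p hp h
    obtain ⟨h1, h2, u', hu1, hu2⟩ := hT p hp
    have hu' : u' ≠ 0 := by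
      rintro rfl
      obtain ⟨t, ht⟩ := mem_line_zero.1 hu1
      simp only [smul_zero] at ht
      exact apply_ne_zero h0 h1.2 ht.symm
    have hne : p.1 ≠ p.2 := fun h => hneT p hp (by simp [h])
    have := h.eq_of_mem (isLine_line 0 hu') (f.injective.ne hne) ⟨_, hj1 p, rfl⟩ ⟨_, hj2 p, rfl⟩
      hu1 hu2
    have h3 : (0 : V) ∈ f '' j p := this ▸ left_mem_line _ _
    obtain ⟨z, hz, hz0⟩ := h3
    rw [← h0] at hz0
    exact hj0 p hp (f.injective hz0 ▸ hz)
  have hparA : ∀ z ∈ line F 0 a, z ∉ line F (s • b) a := by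
    rintro _ ⟨c, rfl⟩ ⟨d, hd⟩
    have := (LinearIndependent.pair_iff.1 hab (d - c) s (by
      have := sub_eq_zero.2 hd
      rw [← this]; module)).2
    exact hs0 this
  have hparB : ∀ z ∈ line F 0 b, z ∉ line F (t • a) b := by
    rintro _ ⟨c, rfl⟩ ⟨d, hd⟩
    have := (LinearIndependent.pair_iff.1 hab t (d - c) (by
      have := sub_eq_zero.2 hd
      rw [← this]; module)).1
    exact ht0 this
  have hne : line F (s • b) a ≠ line F (t • a) b := by
    intro h
    refine hparA (t • a) (smul_mem_line_zero (mem_line_zero_self a) t) ?_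
    rw [h]
    exact left_mem_line _ _
  have hdisj : Disjoint (T.image j) {line F (s • b) a, line F (t • a) b} := by
    rw [Finset.disjoint_left]
    intro L hL hL'
    obtain ⟨p, hp, rfl⟩ := Finset.mem_image.1 hL
    obtain ⟨h1, h2, -⟩ := hT p hp
    rcases Finset.mem_insert.1 hL' with h | h
    · exact hparA _ h1.1 (h ▸ hj1 p)
    · rw [Finset.mem_singleton] at h
      exact hparB _ h2.1 (h ▸ hj2 p)
  have hsub : T.image j ∪ {line F (s • b) a, line F (t • a) b} ⊆ badLinesOff F f P := by
    intro L hL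
    rw [mem_badLinesOff]
    simp only [Finset.mem_union, Finset.mem_image, Finset.mem_insert, Finset.mem_singleton] at hL
    rcases hL with ⟨p, hp, rfl⟩ | rfl | rfl
    · obtain ⟨h1, h2, -⟩ := hT p hp
      have hm1 : p.1 ∈ P := line_subset_submodule P.zero_mem ha h1.1
      have hm2 : p.2 ∈ P := line_subset_submodule P.zero_mem hb h2.1
      exact ⟨⟨hjl p hp, line_subset_submodule hm1 (P.sub_mem hm2 hm1), hjbad p hp⟩, hj0 p hp⟩
    · exact ⟨⟨isLine_line _ ha0, line_subset_submodule (P.smul_mem _ hb) ha, hs⟩,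
        hparA 0 (left_mem_line _ _)⟩
    · exact ⟨⟨isLine_line _ hb0, line_subset_submodule (P.smul_mem _ ha) hb, ht⟩,
        hparB 0 (left_mem_line _ _)⟩
  have hfinal := Finset.card_le_card hsub
  rw [Finset.card_union_of_disjoint hdisj, Finset.card_image_of_injOn hinj, hTcard,
    Finset.card_pair hne] at hfinal
  -- Here i + k + 3 = q. The transversals number 2(i + 1)(k + 1) ≥ 2(i + k + 1) = 2(q - 2), and the
  -- two bad parallels supply the missing 2.
  obtain ⟨i, hi⟩ : ∃ i, (S a a').card = i + 1 := ⟨_, (Nat.sub_add_cancel hpos1).symm⟩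
  obtain ⟨k, hk⟩ : ∃ k, (S a b').card = k + 1 := ⟨_, (Nat.sub_add_cancel hpos2).symm⟩
  have e1 : (S b a').card = k + 1 := by omega
  have e2 : (S b b').card = i + 1 := by omega
  rw [hi, hk, e1, e2] at hfinal
  have e3 : Fintype.card F = i + k + 3 := by omega
  rw [e3]
  nlinarith [Nat.zero_le (i * k)]

end Counting

/-! ### Good lines that force the image of a plane into a plane. -/

section Planes

variable {F V : Type*} [Field F] [AddCommGroup V] [Module F V] {f : Equiv.Perm V}

/-- If all lines through the origin in a plane, other than the one spanned by `x`, are good, then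
the image of a good line through `t • x` lies in any subspace that contains the image of a point
of it and the image of another line through the origin meeting it elsewhere. -/
theorem image_line_subset (h0 : f 0 = 0) {x b : V} (hxb : LinearIndependent F ![x, b])
    (hg : ∀ u : F, IsLine F (f '' line F 0 (b + u • x))) {t s u : F}
    (hL : IsLine F (f '' line F (t • x) (b + s • x))) (hu : u ≠ s) {Q : Submodule F V}
    {z : V} (hz : z ∈ line F (t • x) (b + s • x)) (hz' : z ∉ line F 0 (b + u • x)) (hzQ : f z ∈ Q)
    (huQ : f (b + u • x) ∈ Q) : f '' line F (t • x) (b + s • x) ⊆ Q := by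
  have hus : u - s ≠ 0 := sub_ne_zero.2 hu
  have h1 : (t / (u - s)) • (b + u • x) ∈ line F (t • x) (b + s • x) := by
    refine ⟨t / (u - s), ?_⟩
    have h2 : t = t / (u - s) * (u - s) := (div_mul_cancel₀ _ hus).symm
    nth_rewrite 1 [h2]
    module
  refine hL.subset_submodule (x := f z) (y := f ((t / (u - s)) • (b + u • x))) ?_ ⟨_, hz, rfl⟩
    ⟨_, h1, rfl⟩ hzQ
    (apply_smul_mem_submodule h0 (add_smul_ne_zero hxb u) (hg u) huQ _)
  intro h
  apply hz'
  rw [f.injective h]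
  exact smul_mem_line_zero (mem_line_zero_self _) _

theorem smul_notMem_line {x b : V} (hxb : LinearIndependent F ![x, b]) {t : F} (ht : t ≠ 0)
    (u : F) : t • x ∉ line F 0 (b + u • x) := by
  intro h
  obtain ⟨c, hc⟩ := mem_line_zero.1 h
  have h1 : (c * u - t) • x + c • b = 0 := by
    have := sub_eq_zero.2 hc
    rw [← this]
    module
  obtain ⟨h2, h3⟩ := LinearIndependent.pair_iff.1 hxb _ _ h1
  rw [h3] at h2
  apply ht
  linear_combination -h2

theorem add_smul_notMem_line {x b : V} (hxb : LinearIndependent F ![x, b]) {u v : F}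
    (huv : u ≠ v) : b + u • x ∉ line F 0 (b + v • x) := by
  intro h
  obtain ⟨c, hc⟩ := mem_line_zero.1 h
  have h1 : (c * v - u) • x + (c - 1) • b = 0 := by
    have := sub_eq_zero.2 hc
    rw [← this]
    module
  obtain ⟨h2, h3⟩ := LinearIndependent.pair_iff.1 hxb _ _ h1
  apply huv
  linear_combination -h2 + v * h3

/-- Two good lines through one point of `line F 0 x` and one good line through another of its
points force the images of all lines through the origin into one plane. -/
theorem exists_submodule_of_three_good [Fintype F] (hq : 3 ≤ Fintype.card F) (h0 : f 0 = 0)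
    {x b : V} (hxb : LinearIndependent F ![x, b])
    (hg : ∀ u : F, IsLine F (f '' line F 0 (b + u • x))) {t t' s s' r : F} (ht : t ≠ 0)
    (ht' : t' ≠ 0) (hss : s ≠ s')
    (h1 : IsLine F (f '' line F (t • x) (b + s • x)))
    (h2 : IsLine F (f '' line F (t • x) (b + s' • x)))
    (h3 : IsLine F (f '' line F (t' • x) (b + r • x))) :
    ∃ Q : Submodule F V, Module.finrank F Q = 2 ∧ f (t • x) ∈ Q ∧ f (t' • x) ∈ Q ∧
      ∀ u : F, f (b + u • x) ∈ Q := by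
  -- The choice of `c` makes `u = s + c` different from both `s` and `s'`.
  obtain ⟨c, hc0, hc1⟩ := exists_ne_zero_ne hq (s' - s)
  have hus : s + c ≠ s := by simpa using hc0
  have hus' : s + c ≠ s' := fun h => hc1 (by rw [← h]; ring)
  have hx : ∀ u : F, t • x ∉ line F 0 (b + u • x) := smul_notMem_line hxb ht
  set u := s + c with hu
  have hind : LinearIndependent F ![f (b + u • x), f (t • x)] :=
    indep_image h0 ((indep_iff (add_smul_ne_zero hxb u)).2 (hx u)) (hg u)
  set Q := Submodule.span F {f (b + u • x), f (t • x)} with hQ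
  have huQ : f (b + u • x) ∈ Q := Submodule.subset_span (by simp)
  have htQ : f (t • x) ∈ Q := Submodule.subset_span (by simp)
  -- The image of a good line through `t • x` lies in `Q`, and the line crosses every line through 0
  -- of direction `b + v • x` with `v ≠ s`, away from 0. The two values `s`, `s'` together reach all
  -- `v`.
  have key : ∀ s : F, IsLine F (f '' line F (t • x) (b + s • x)) → u ≠ s → ∀ v : F, v ≠ s →
      f (b + v • x) ∈ Q := by
    intro s hs hus v hv
    have hsub := image_line_subset h0 hxb hg hs hus (left_mem_line _ _) (hx u) htQ huQ
    have hvs : v - s ≠ 0 := sub_ne_zero.2 hv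
    have hmem : (t / (v - s)) • (b + v • x) ∈ line F (t • x) (b + s • x) := by
      refine ⟨t / (v - s), ?_⟩
      have h2 : t = t / (v - s) * (v - s) := (div_mul_cancel₀ _ hvs).symm
      nth_rewrite 1 [h2]
      module
    have hne : t / (v - s) ≠ 0 := div_ne_zero ht hvs
    have hQ' := hsub ⟨_, hmem, rfl⟩
    have hl : line F 0 ((t / (v - s)) • (b + v • x)) = line F 0 (b + v • x) :=
      line_smul _ _ hne
    have := apply_smul_mem_submodule h0 (smul_ne_zero hne (add_smul_ne_zero hxb v))
      (by rw [hl]; exact hg v) hQ' (t / (v - s))⁻¹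
    rwa [smul_smul, inv_mul_cancel₀ hne, one_smul] at this
  have hall : ∀ v : F, f (b + v • x) ∈ Q := by
    intro v
    by_cases hv : v = s
    · exact key s' h2 hus' v (by rw [hv]; exact hss)
    · exact key s h1 hus v hv
  refine ⟨Q, finrank_span_pair hind, htQ, ?_, hall⟩
  -- The third good line crosses the lines of directions `b + (r + 1) • x` and `b + (r + d) • x` at
  -- distinct points with images in `Q`, which brings `f (t' • x)` into `Q`.
  obtain ⟨d, hd0, hd1⟩ := exists_ne_zero_ne hq (1 : F)
  have hm : ((t' * 1) • (b + (r + 1) • x)) ∈ line F (t' • x) (b + r • x) := ⟨t', by module⟩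
  have hm' : (t' * 1) • (b + (r + 1) • x) ∉ line F 0 (b + (r + d) • x) := by
    intro h
    have := smul_mem_line_zero h (t' * 1)⁻¹
    rw [smul_smul, inv_mul_cancel₀ (by simpa using ht'), one_smul] at this
    exact add_smul_notMem_line hxb (fun h => hd1 (add_left_cancel h).symm) this
  exact image_line_subset h0 hxb hg h3 (u := r + d) (by simpa using hd0) hm hm'
    (apply_smul_mem_submodule h0 (add_smul_ne_zero hxb _) (hg _) (hall _) _) (hall _)
    ⟨_, left_mem_line _ _, rfl⟩

/-- If all lines through the origin in a plane are good, and two good lines not through the origin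
are not parallel, then the image of the plane is a plane. -/
theorem image_subset_of_two_good [Fintype F] (hq : 3 ≤ Fintype.card F) (h0 : f 0 = 0)
    {P : Submodule F V} (hP : Module.finrank F P = 2)
    (hg : ∀ z ∈ P, z ≠ 0 → IsLine F (f '' line F 0 z)) {x₁ d₁ x₂ d₂ : V} (hx₁ : x₁ ∈ P)
    (hx₂ : x₂ ∈ P) (hd₁ : d₁ ∈ P) (hd₂ : d₂ ∈ P) (hd : LinearIndependent F ![d₁, d₂])
    (hn₁ : x₁ ∉ line F 0 d₁) (hn₂ : x₂ ∉ line F 0 d₂) (h1 : IsLine F (f '' line F x₁ d₁))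
    (h2 : IsLine F (f '' line F x₂ d₂)) :
    ∃ Q : Submodule F V, Module.finrank F Q = 2 ∧ ∀ z ∈ P, f z ∈ Q := by
  have meet : ∀ x d u : V, x ∈ P → d ∈ P → u ∈ P → LinearIndependent F ![d, u] →
      x ∉ line F 0 d → ∃ t : F, t ≠ 0 ∧ t • u ∈ line F x d := by
    intro x d u hx hd hu hdu hxd
    obtain ⟨a, b, rfl⟩ := indep_mem_combo hP hd hu hdu hx
    refine ⟨b, ?_, -a, by module⟩
    rintro rfl
    exact hxd (mem_line_zero.2 ⟨a, by simp⟩)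
  have hpi := LinearIndependent.pair_iff.1 hd
  -- The directions `d₁ + d₂` and `d₁ + c • d₂` are parallel to neither good line, so both good
  -- lines cross them; their images span `Q`.
  obtain ⟨c, hc0, hc1⟩ := exists_ne_zero_ne hq (1 : F)
  have hmP : ∀ c : F, d₁ + c • d₂ ∈ P := fun c => P.add_mem hd₁ (P.smul_mem c hd₂)
  have hm0 : ∀ c : F, d₁ + c • d₂ ≠ 0 := by
    intro c h
    have := hpi 1 c (by simpa using h)
    simp at this
  have hm1 : ∀ c : F, c ≠ 0 → LinearIndependent F ![d₁, d₁ + c • d₂] := by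
    intro c hc
    rw [LinearIndependent.pair_iff]
    intro s t hst
    obtain ⟨e1, e2⟩ := hpi (s + t) (t * c) (by rw [← hst]; module)
    have ht : t = 0 := (mul_eq_zero.1 e2).resolve_right hc
    exact ⟨by rw [ht] at e1; simpa using e1, ht⟩
  have hm2 : ∀ c : F, c ≠ 0 → LinearIndependent F ![d₂, d₁ + c • d₂] := by
    intro c hc
    rw [LinearIndependent.pair_iff]
    intro s t hst
    obtain ⟨e1, e2⟩ := hpi t (s + t * c) (by rw [← hst]; module)
    exact ⟨by rw [e1] at e2; simpa using e2, e1⟩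
  have hind : LinearIndependent F ![d₁ + (1 : F) • d₂, d₁ + c • d₂] := by
    rw [LinearIndependent.pair_iff]
    intro s t hst
    obtain ⟨e1, e2⟩ := hpi (s + t) (s + t * c) (by rw [← hst]; module)
    have h3 : t * (c - 1) = 0 := by linear_combination e2 - e1
    rcases mul_eq_zero.1 h3 with h3 | h3
    · exact ⟨by rw [h3] at e1; simpa using e1, h3⟩
    · exact absurd (sub_eq_zero.1 h3) hc1
  have hind' := indep_image h0 hind (hg _ (hmP 1) (hm0 1))
  set Q := Submodule.span F {f (d₁ + (1 : F) • d₂), f (d₁ + c • d₂)} with hQ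
  have hQ1 : f (d₁ + (1 : F) • d₂) ∈ Q := Submodule.subset_span (by simp)
  have hQ2 : f (d₁ + c • d₂) ∈ Q := Submodule.subset_span (by simp)
  have hsub : ∀ x d : V, x ∈ P → d ∈ P → x ∉ line F 0 d → IsLine F (f '' line F x d) →
      LinearIndependent F ![d, d₁ + (1 : F) • d₂] → LinearIndependent F ![d, d₁ + c • d₂] →
      ∀ u ∈ P, LinearIndependent F ![d, u] → f u ∈ Q := by
    intro x d hx hd hn hl i1 i2 u hu hdu
    obtain ⟨t₁, ht₁, hm₁⟩ := meet x d _ hx hd (hmP 1) i1 hn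
    obtain ⟨t₂, ht₂, hm₂⟩ := meet x d _ hx hd (hmP c) i2 hn
    obtain ⟨t, ht, hm⟩ := meet x d u hx hd hu hdu hn
    have hlQ : f '' line F x d ⊆ Q := by
      refine hl.subset_submodule ?_ ⟨_, hm₁, rfl⟩ ⟨_, hm₂, rfl⟩
        (apply_smul_mem_submodule h0 (hm0 1) (hg _ (hmP 1) (hm0 1)) hQ1 _)
        (apply_smul_mem_submodule h0 (hm0 c) (hg _ (hmP c) (hm0 c)) hQ2 _)
      intro he
      have he := f.injective he
      have := (LinearIndependent.pair_iff.1 hind t₁ (-t₂) (by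
        rw [neg_smul, ← sub_eq_add_neg, sub_eq_zero]; exact he)).1
      exact ht₁ this
    have hu0 := indep_right_ne_zero hdu
    have := apply_smul_mem_submodule h0 (smul_ne_zero ht hu0)
      (hg _ (P.smul_mem t hu) (smul_ne_zero ht hu0)) (hlQ ⟨_, hm, rfl⟩) t⁻¹
    rwa [smul_smul, inv_mul_cancel₀ ht, one_smul] at this
  refine ⟨Q, finrank_span_pair hind', fun z hz => ?_⟩
  by_cases hz0 : z = 0
  · rw [hz0, h0]
    exact Q.zero_mem
  -- The good line of direction `d₁` reaches every line through 0 except its own parallel, which the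
  -- other good line reaches.
  by_cases hz1 : z ∈ line F 0 d₁
  · refine hsub x₂ d₂ hx₂ hd₂ hn₂ h2 (hm2 1 one_ne_zero) (hm2 c hc0) z hz ?_
    rw [indep_iff (indep_right_ne_zero hd)]
    exact fun h => hz0 (eq_zero_of_mem_of_mem hd hz1 h)
  · exact hsub x₁ d₁ hx₁ hd₁ hn₁ h1 (hm1 1 one_ne_zero) (hm1 c hc0) z hz
      ((indep_iff (indep_left_ne_zero hd)).2 hz1)

end Planes

/-! ### Planes with one bad line through the origin. -/

section PlaneCounts

variable {F V : Type*} [Field F] [AddCommGroup V] [Module F V] [Fintype V]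
  {f : Equiv.Perm V}

/-- A set of bad lines of the plane spanned by `a`, `b`, none through the origin and none
parallel to `a`, is counted by its parameters. -/
theorem card_le_card_badLinesOff {P : Submodule F V} {a b : V} (ha : a ∈ P) (hb : b ∈ P)
    (hab : LinearIndependent F ![a, b]) (S : Finset (F × F))
    (hS : ∀ p ∈ S, p.1 ≠ 0 ∧ ¬ IsLine F (f '' line F (p.1 • a) (b + p.2 • a))) :
    S.card ≤ (badLinesOff F f P).card := by
  apply Finset.card_le_card_of_injOn fun p => line F (p.1 • a) (b + p.2 • a)
  · intro p hp
    obtain ⟨h1, h2⟩ := hS p hp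
    rw [Finset.mem_coe, mem_badLinesOff]
    exact ⟨⟨isLine_line _ (add_smul_ne_zero hab _), line_subset_submodule (P.smul_mem _ ha)
      (P.add_mem hb (P.smul_mem _ ha)), h2⟩, fun h => h1 (zero_mem_line_smul_add hab h)⟩
  · intro p _ r _ h
    obtain ⟨h1, h2⟩ := line_smul_add_injective hab h
    exact Prod.ext h1 h2

variable [Fintype F]

/-- A plane minus a line. -/
theorem card_plane_sdiff_line {P : Submodule F V} (hP : Module.finrank F P = 2) {a : V}
    (ha : a ∈ P) (ha0 : a ≠ 0) :
    (Finset.univ.filter fun z => z ∈ P ∧ z ∉ line F 0 a).card + Fintype.card F =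
      Fintype.card F ^ 2 := by
  rw [← card_plane hP, ← card_filter_mem_line (F := F) 0 ha0, ← Finset.card_union_of_disjoint]
  · congr 1
    ext z
    simp only [Finset.mem_union, Finset.mem_filter, Finset.mem_univ, true_and]
    constructor
    · rintro (h | h)
      · exact h.1
      · exact line_subset_submodule P.zero_mem ha h
    · intro h
      by_cases hz : z ∈ line F 0 a
      · exact Or.inr hz
      · exact Or.inl ⟨h, hz⟩
  · rw [Finset.disjoint_left]
    intro z hz hz'
    simp only [Finset.mem_filter, Finset.mem_univ, true_and] at hz hz'
    exact hz.2 hz'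

/-- A plane in which exactly one line through the origin is bad, with image contained in the union
of two lines that meet the rest of the image of the plane only in the origin, contains at least
`q` bad lines not through the origin. -/
theorem card_badLinesOff_of_one_bad (hq : 3 ≤ Fintype.card F) {P : Submodule F V} (h0 : f 0 = 0)
    (hP : Module.finrank F P = 2) {a a' b' : V} (ha : a ∈ P) (ha0 : a ≠ 0)
    (hA : ¬ IsLine F (f '' line F 0 a))
    (hg : ∀ z ∈ P, z ∉ line F 0 a → IsLine F (f '' line F 0 z))
    (hab' : LinearIndependent F ![a', b'])
    (him : ∀ z ∈ line F 0 a, f z ∈ line F 0 a' ∪ line F 0 b')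
    (hout : ∀ z ∈ P, z ∉ line F 0 a → f z ∉ line F 0 a' ∪ line F 0 b') :
    Fintype.card F ≤ (badLinesOff F f P).card := by
  obtain ⟨b, hb, hba⟩ := exists_mem_notMem_line hP.ge a
  have hab : LinearIndependent F ![a, b] := (indep_iff ha0).2 hba
  obtain ⟨_, hx₁, hx₁0, hx₁a⟩ := exists_apply_mem h0 ha0 (indep_right_ne_zero hab') hA him
  obtain ⟨_, hx₂, hx₂0, hx₂b⟩ := exists_apply_mem h0 ha0 (indep_left_ne_zero hab') hA
    (fun z hz => (him z hz).symm)
  obtain ⟨t, rfl⟩ := mem_line_zero.1 hx₁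
  obtain ⟨t', rfl⟩ := mem_line_zero.1 hx₂
  have ht : t ≠ 0 := by
    rintro rfl
    simp at hx₁0
  have ht' : t' ≠ 0 := by
    rintro rfl
    simp at hx₂0
  have htt : t ≠ t' := by
    rintro rfl
    exact apply_ne_zero h0 hx₁0 (eq_zero_of_mem_of_mem hab' hx₁a hx₂b)
  have hline : ∀ u : F, b + u • a ∉ line F 0 a := by
    intro u h
    obtain ⟨c, hc⟩ := mem_line_zero.1 h
    exact hba (mem_line_zero.2 ⟨c - u, by rw [sub_smul, hc]; abel⟩)
  have hg' : ∀ u : F, IsLine F (f '' line F 0 (b + u • a)) := fun u =>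
    hg _ (P.add_mem hb (P.smul_mem _ ha)) (hline u)
  let G : F → Finset F := fun t =>
    Finset.univ.filter fun s => IsLine F (f '' line F (t • a) (b + s • a))
  let B : F → Finset F := fun t =>
    Finset.univ.filter fun s => ¬ IsLine F (f '' line F (t • a) (b + s • a))
  have hGB : ∀ t, (G t).card + (B t).card = Fintype.card F := fun t => by
    rw [← Finset.card_univ]
    exact Finset.card_filter_add_card_filter_not _
  have hcount : (B t).card + (B t').card ≤ (badLinesOff F f P).card := by
    have hdisj : Disjoint ({t} ×ˢ B t) ({t'} ×ˢ B t') := by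
      rw [Finset.disjoint_left]
      intro p hp hp'
      simp only [Finset.mem_product, Finset.mem_singleton] at hp hp'
      exact htt (hp.1.symm.trans hp'.1)
    have := card_le_card_badLinesOff (f := f) ha hb hab (({t} ×ˢ B t) ∪ ({t'} ×ˢ B t')) (by
      intro p hp
      simp only [Finset.mem_union, Finset.mem_product, Finset.mem_singleton] at hp
      rcases hp with ⟨h1, h2⟩ | ⟨h1, h2⟩
      · rw [h1]
        exact ⟨ht, (Finset.mem_filter.1 h2).2⟩
      · rw [h1]
        exact ⟨ht', (Finset.mem_filter.1 h2).2⟩)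
    rw [Finset.card_union_of_disjoint hdisj, Finset.card_product, Finset.card_product,
      Finset.card_singleton, Finset.card_singleton, one_mul, one_mul] at this
    exact this
  -- Each of `t • a`, `t' • a` lies on q lines of `P` besides that of `a`. With fewer than q bad
  -- lines, at least q + 1 of these 2q lines are good, so one point is on two good lines and the
  -- other on at least one.
  by_contra! hlt
  have hQ : ∃ Q : Submodule F V, Module.finrank F Q = 2 ∧ f (t • a) ∈ Q ∧ f (t' • a) ∈ Q ∧
      ∀ u : F, f (b + u • a) ∈ Q := by
    have e1 := hGB t
    have e2 := hGB t'
    have hmem : ∀ t s, s ∈ G t ↔ IsLine F (f '' line F (t • a) (b + s • a)) := by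
      intro t s
      simp [G]
    rcases lt_or_ge 1 (G t).card with h | h
    · obtain ⟨s, hs, s', hs', hss⟩ := Finset.one_lt_card.1 h
      obtain ⟨r, hr⟩ : (G t').Nonempty := Finset.card_pos.1 (by omega)
      rw [hmem] at hs hs' hr
      exact exists_submodule_of_three_good hq h0 hab hg' ht ht' hss hs hs' hr
    · have h' : 1 < (G t').card := by omega
      obtain ⟨s, hs, s', hs', hss⟩ := Finset.one_lt_card.1 h'
      obtain ⟨r, hr⟩ : (G t).Nonempty := Finset.card_pos.1 (by omega)
      rw [hmem] at hs hs' hr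
      obtain ⟨Q, hQ, h1, h2, h3⟩ :=
        exists_submodule_of_three_good hq h0 hab hg' ht' ht hss hs hs' hr
      exact ⟨Q, hQ, h2, h1, h3⟩
  obtain ⟨Q, hQ, htQ, htQ', huQ⟩ := hQ
  have hfQ : ∀ z ∈ P, z ∉ line F 0 a → f z ∈ Q := by
    intro z hz hza
    obtain ⟨c, d, rfl⟩ := indep_mem_combo hP ha hb hab hz
    have hd : d ≠ 0 := by
      rintro rfl
      exact hza (mem_line_zero.2 ⟨c, by simp⟩)
    have := apply_smul_mem_submodule h0 (add_smul_ne_zero hab (c / d)) (hg' _) (huQ (c / d)) d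
    rwa [smul_add, smul_smul, mul_div_cancel₀ _ hd, add_comm] at this
  have hunion : line F 0 a' ∪ line F 0 b' ⊆ Q := by
    rw [line_zero_eq_of_mem hx₁a (apply_ne_zero h0 hx₁0),
      line_zero_eq_of_mem hx₂b (apply_ne_zero h0 hx₂0)]
    exact Set.union_subset (line_subset_submodule Q.zero_mem htQ)
      (line_subset_submodule Q.zero_mem htQ')
  -- The plane `Q` would contain the image of `P` minus a line and, disjoint from it, two whole
  -- lines: (q² - q) + (2q - 1) > q² points.
  have hbig : (Finset.univ.filter fun z => z ∈ P ∧ z ∉ line F 0 a).card +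
      ((Finset.univ.filter fun z => z ∈ line F 0 a').card +
        (Finset.univ.filter fun z => z ∈ line F 0 b' ∧ z ≠ 0).card) ≤
      (Finset.univ.filter fun z => z ∈ Q).card := by
    rw [← Finset.card_map f.toEmbedding, ← Finset.card_union_of_disjoint,
      ← Finset.card_union_of_disjoint]
    · apply Finset.card_le_card
      intro z hz
      simp only [Finset.mem_union, Finset.mem_map, Finset.mem_filter, Finset.mem_univ, true_and,
        Equiv.coe_toEmbedding] at hz ⊢
      rcases hz with ⟨y, ⟨hy, hya⟩, rfl⟩ | hz | hz
      · exact hfQ y hy hya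
      · exact hunion (Or.inl hz)
      · exact hunion (Or.inr hz.1)
    · rw [Finset.disjoint_left]
      intro z hz hz'
      simp only [Finset.mem_union, Finset.mem_map, Finset.mem_filter, Finset.mem_univ, true_and,
        Equiv.coe_toEmbedding] at hz hz'
      obtain ⟨y, ⟨hy, hya⟩, rfl⟩ := hz
      exact hout y hy hya (hz'.imp id And.left)
    · rw [Finset.disjoint_left]
      intro z hz hz'
      simp only [Finset.mem_filter, Finset.mem_univ, true_and] at hz hz'
      exact hz'.2 (eq_zero_of_mem_of_mem hab' hz hz'.1)
  have hPA := card_plane_sdiff_line hP ha ha0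
  rw [card_plane hQ, card_filter_mem_line 0 (indep_left_ne_zero hab')] at hbig
  have := card_filter_mem_line_zero (F := F) (indep_right_ne_zero hab')
  omega

/-- Each of the q - 1 nonzero points on the line of `a` lies on q other lines of `P`, and these (q -
1)q lines avoid 0, so they cannot all be bad. -/
theorem exists_good_not_parallel {P : Submodule F V} (hP : Module.finrank F P = 2) {a : V}
    (ha : a ∈ P) (ha0 : a ≠ 0)
    (hlt : (badLinesOff F f P).card < (Fintype.card F - 1) * Fintype.card F) :
    ∃ x ∈ P, ∃ d ∈ P, LinearIndependent F ![a, d] ∧ x ∉ line F 0 d ∧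
      IsLine F (f '' line F x d) := by
  obtain ⟨b, hb, hba⟩ := exists_mem_notMem_line hP.ge a
  have hab : LinearIndependent F ![a, b] := (indep_iff ha0).2 hba
  by_contra! h
  have := card_le_card_badLinesOff (f := f) ha hb hab
    ((Finset.univ.erase 0) ×ˢ Finset.univ) (by
      intro p hp
      have hp0 : p.1 ≠ 0 := by simpa using hp
      refine ⟨hp0, h _ (P.smul_mem _ ha) _ (P.add_mem hb (P.smul_mem _ ha)) ?_
        (smul_notMem_line hab hp0 _)⟩
      rw [LinearIndependent.pair_iff]
      intro s t hst
      obtain ⟨h1, h2⟩ := LinearIndependent.pair_iff.1 hab (s + t * p.2) t (by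
        rw [← hst]; module)
      exact ⟨by rw [h2] at h1; simpa using h1, h2⟩)
  rw [Finset.card_product, Finset.card_erase_of_mem (Finset.mem_univ _), Finset.card_univ] at this
  omega

end PlaneCounts

/-! ### Moving the origin by translations. -/

section Recenter

variable {F V : Type*} [Field F] [AddCommGroup V] [Module F V]

/-- The permutation `f` composed with translations such that `s` becomes the origin and is fixed. -/
def recenter (f : Equiv.Perm V) (s : V) : Equiv.Perm V :=
  (Equiv.addLeft s).trans (f.trans (Equiv.addLeft (-f s)))

theorem recenter_apply (f : Equiv.Perm V) (s x : V) : recenter f s x = -f s + f (s + x) := rfl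

theorem recenter_zero (f : Equiv.Perm V) (s : V) : recenter f s 0 = 0 := by
  simp [recenter_apply]

theorem isLine_recenter_image (f : Equiv.Perm V) (s : V) (L : Set V) :
    IsLine F (recenter f s '' L) ↔ IsLine F (f '' ((fun z => s + z) '' L)) := by
  rw [← isLine_image_add_iff (-f s) (L := f '' ((fun z => s + z) '' L))]
  rw [Set.image_image, Set.image_image]
  rfl

theorem image_neg_add_image_add (s : V) (L : Set V) :
    (fun z => -s + z) '' ((fun z => s + z) '' L) = L := by
  rw [Set.image_image]
  simp only [neg_add_cancel_left, Set.image_id']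

theorem image_add_image_neg_add (s : V) (L : Set V) :
    (fun z => s + z) '' ((fun z => -s + z) '' L) = L := by
  rw [Set.image_image]
  simp only [add_neg_cancel_left, Set.image_id']

theorem image_add_submodule {P : Submodule F V} {s : V} (hs : s ∈ P) :
    (fun z => s + z) '' (P : Set V) = P := by
  ext z
  constructor
  · rintro ⟨y, hy, rfl⟩
    exact P.add_mem hs hy
  · intro hz
    exact ⟨-s + z, P.add_mem (P.neg_mem hs) hz, by simp⟩

variable [Fintype V]

theorem mem_badLines_recenter (f : Equiv.Perm V) (s : V) {U : Set V}
    (hU : (fun z => s + z) '' U = U) (L : Set V) :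
    L ∈ badLines F (recenter f s) U ↔ (fun z => s + z) '' L ∈ badLines F f U := by
  rw [mem_badLines, mem_badLines, isLine_recenter_image, isLine_image_add_iff]
  conv_rhs => rw [← hU]
  rw [Set.image_subset_image_iff (add_right_injective s)]

theorem card_badLines_recenter (f : Equiv.Perm V) (s : V) {U : Set V}
    (hU : (fun z => s + z) '' U = U) :
    (badLines F (recenter f s) U).card = (badLines F f U).card := by
  refine Finset.card_nbij' (fun L => (fun z => s + z) '' L) (fun L => (fun z => -s + z) '' L)
    ?_ ?_ ?_ ?_
  · intro L hL
    exact (mem_badLines_recenter f s hU L).1 hL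
  · intro L hL
    simp only [Finset.mem_coe]
    rw [mem_badLines_recenter f s hU, image_add_image_neg_add]
    exact hL
  · intro L _
    exact image_neg_add_image_add s L
  · intro L _
    exact image_add_image_neg_add s L

theorem card_badLinesThrough_recenter (f : Equiv.Perm V) (s : V) {U : Set V}
    (hU : (fun z => s + z) '' U = U) :
    (badLinesThrough F (recenter f s) U).card =
      ((badLines F f U).filter fun L => s ∈ L).card := by
  refine Finset.card_nbij' (fun L => (fun z => s + z) '' L) (fun L => (fun z => -s + z) '' L)
    ?_ ?_ ?_ ?_
  · intro L hL
    rw [Finset.mem_coe, badLinesThrough, Finset.mem_filter] at hL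
    rw [Finset.mem_coe, Finset.mem_filter]
    exact ⟨(mem_badLines_recenter f s hU L).1 hL.1, 0, hL.2, by simp⟩
  · intro L hL
    rw [Finset.mem_coe, Finset.mem_filter] at hL
    rw [Finset.mem_coe, badLinesThrough, Finset.mem_filter, mem_badLines_recenter f s hU,
      image_add_image_neg_add]
    exact ⟨hL.1, s, hL.2, by simp⟩
  · intro L _
    exact image_neg_add_image_add s L
  · intro L _
    exact image_add_image_neg_add s L

end Recenter

/-! ### A plane with all lines through the origin good has no bad line or at least 2q. -/

section PlaneBound

variable {F V : Type*} [Field F] [AddCommGroup V] [Module F V] [Fintype V]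
  {f : Equiv.Perm V}

theorem two_le_card_badLinesThrough {U : Submodule F V} {a b : V} (ha : a ∈ U) (hb : b ∈ U)
    (hab : LinearIndependent F ![a, b]) (hA : ¬ IsLine F (f '' line F 0 a))
    (hB : ¬ IsLine F (f '' line F 0 b)) : 2 ≤ (badLinesThrough F f U).card := by
  have ha0 := indep_left_ne_zero hab
  have hb0 := indep_right_ne_zero hab
  rw [← Finset.card_pair (a := line F 0 a) (b := line F 0 b)]
  · apply Finset.card_le_card
    intro L hL
    rw [mem_badLinesThrough]
    simp only [Finset.mem_insert, Finset.mem_singleton] at hL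
    rcases hL with rfl | rfl
    · exact ⟨⟨isLine_line _ ha0, line_subset_submodule U.zero_mem ha, hA⟩, left_mem_line _ _⟩
    · exact ⟨⟨isLine_line _ hb0, line_subset_submodule U.zero_mem hb, hB⟩, left_mem_line _ _⟩
  · intro h
    rw [indep_iff ha0] at hab
    exact hab (h ▸ mem_line_zero_self b)

theorem badLinesThrough_eq_empty {U : Submodule F V}
    (hg : ∀ z ∈ U, z ≠ 0 → IsLine F (f '' line F 0 z)) : badLinesThrough F f U = ∅ := by
  rw [Finset.eq_empty_iff_forall_notMem]
  intro L hL
  rw [mem_badLinesThrough] at hL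
  obtain ⟨⟨h1, h2, h3⟩, h4⟩ := hL
  obtain ⟨v, hv, rfl⟩ := h1.exists_eq h4
  exact h3 (hg v (h2 (mem_line_zero_self v)) hv)

variable [Fintype F]

/-- If at most two lines of `U` through the origin are bad, then none or exactly two are. -/
theorem good_or_two_bad {U U' : Submodule F V} (h0 : f 0 = 0) (hU : f '' U = (U' : Set V))
    (hcard : (badLinesThrough F f U).card ≤ 2) :
    (∀ z ∈ U, z ≠ 0 → IsLine F (f '' line F 0 z)) ∨
    ∃ a ∈ U, ∃ b ∈ U, LinearIndependent F ![a, b] ∧ ¬ IsLine F (f '' line F 0 a) ∧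
      ¬ IsLine F (f '' line F 0 b) ∧
      ∀ z ∈ U, z ∉ line F 0 a → z ∉ line F 0 b → IsLine F (f '' line F 0 z) := by
  rw [or_iff_not_imp_left]
  intro h
  push Not at h
  obtain ⟨a, ha, ha0, hA⟩ := h
  have h' := mt (good_of_all_others_good h0 hU ha ha0) hA
  push Not at h'
  obtain ⟨b, hb, hba, hB⟩ := h'
  have hab : LinearIndependent F ![a, b] := (indep_iff ha0).2 hba
  refine ⟨a, ha, b, hb, hab, hA, hB, fun z hz hza hzb => ?_⟩
  by_contra hZ
  have hz0 : z ≠ 0 := fun h => hza (h ▸ left_mem_line _ _)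
  have hb0 := indep_right_ne_zero hab
  have hsub : ({line F 0 a, line F 0 b, line F 0 z} : Finset (Set V)) ⊆ badLinesThrough F f U := by
    intro L hL
    rw [mem_badLinesThrough]
    simp only [Finset.mem_insert, Finset.mem_singleton] at hL
    rcases hL with rfl | rfl | rfl
    · exact ⟨⟨isLine_line _ ha0, line_subset_submodule U.zero_mem ha, hA⟩, left_mem_line _ _⟩
    · exact ⟨⟨isLine_line _ hb0, line_subset_submodule U.zero_mem hb, hB⟩, left_mem_line _ _⟩
    · exact ⟨⟨isLine_line _ hz0, line_subset_submodule U.zero_mem hz, hZ⟩, left_mem_line _ _⟩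
  have h3 := Finset.card_le_card hsub
  rw [Finset.card_eq_three.2 ⟨line F 0 a, line F 0 b, line F 0 z, ?_, ?_, ?_, rfl⟩] at h3
  · omega
  · intro h
    exact hba (h ▸ mem_line_zero_self b)
  · intro h
    exact hza (h ▸ mem_line_zero_self z)
  · intro h
    exact hzb (h ▸ mem_line_zero_self z)

/-- Through some point of a bad line there are at most two bad lines, if there are fewer
than `2 q` of them. -/
theorem exists_card_filter_le_two {U : Set V} (hlt : (badLines F f U).card < 2 * Fintype.card F)
    {L : Set V} (hL : L ∈ badLines F f U) :
    ∃ s ∈ L, ((badLines F f U).filter fun M => s ∈ M).card ≤ 2 := by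
  -- Otherwise each of the q points of `L` lies on two further bad lines. Lines from different
  -- points are different, because two lines share at most one point, so there are at least 2q.
  by_contra! h
  have hLl := (mem_badLines.1 hL).1
  let S : Finset V := Finset.univ.filter fun s => s ∈ L
  have hS : S.card = Fintype.card F := by
    obtain ⟨x, v, hv, rfl⟩ := hLl
    exact card_filter_mem_line x hv
  have hsub : S.biUnion (fun s => ((badLines F f U).filter fun M => s ∈ M).erase L) ⊆
      badLines F f U := by
    intro M hM
    obtain ⟨s, -, hs⟩ := Finset.mem_biUnion.1 hM
    exact (Finset.mem_filter.1 (Finset.mem_of_mem_erase hs)).1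
  have h1 := Finset.card_le_card hsub
  rw [Finset.card_biUnion] at h1
  · have h2 : S.card * 2 ≤
        ∑ s ∈ S, (((badLines F f U).filter fun M => s ∈ M).erase L).card := by
      rw [← smul_eq_mul]
      apply Finset.card_nsmul_le_sum
      intro s hs
      have hsL : s ∈ L := (Finset.mem_filter.1 hs).2
      have := h s hsL
      rw [Finset.card_erase_of_mem (Finset.mem_filter.2 ⟨hL, hsL⟩)]
      omega
    omega
  · intro s hs t ht hst
    rw [Function.onFun, Finset.disjoint_left]
    intro M hM hM'
    rw [Finset.mem_erase, Finset.mem_filter] at hM hM'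
    exact hM.1 ((mem_badLines.1 hM.2.1).1.eq_of_mem hLl hst hM.2.2 hM'.2.2
      (Finset.mem_filter.1 hs).2 (Finset.mem_filter.1 ht).2)

/-- If all lines through the origin in a plane are good, but not all lines of this plane are good,
then at least `2 q` are bad. -/
theorem card_badLinesOff_of_good (hq : 3 ≤ Fintype.card F) {P : Submodule F V} (h0 : f 0 = 0)
    (hP : Module.finrank F P = 2) (hg : ∀ z ∈ P, z ≠ 0 → IsLine F (f '' line F 0 z))
    (hne : (badLines F f P).Nonempty) : 2 * Fintype.card F ≤ (badLinesOff F f P).card := by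
  by_contra! hlt
  -- As (q - 1)q ≥ 2q, good lines off 0 exist in a direction outside any prescribed one, hence in
  -- two different directions.
  have hlt' : (badLinesOff F f P).card < (Fintype.card F - 1) * Fintype.card F :=
    hlt.trans_le (Nat.mul_le_mul_right _ (by omega))
  have hthrough := badLinesThrough_eq_empty hg
  have htotal := card_badLines (F := F) f (P : Set V)
  rw [hthrough, Finset.card_empty, zero_add] at htotal
  obtain ⟨u, hu, hu0⟩ := exists_mem_notMem_line (F := F) hP.ge (0 : V)
  have hu0 : u ≠ 0 := by
    rintro rfl
    exact hu0 (left_mem_line _ _)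
  obtain ⟨x₁, hx₁, d₁, hd₁, hud, hn₁, hl₁⟩ := exists_good_not_parallel hP hu hu0 hlt'
  obtain ⟨x₂, hx₂, d₂, hd₂, hdd, hn₂, hl₂⟩ :=
    exists_good_not_parallel hP hd₁ (indep_right_ne_zero hud) hlt'
  obtain ⟨Q, hQ, hPQ⟩ :=
    image_subset_of_two_good hq h0 hP hg hx₁ hx₂ hd₁ hd₂ hdd hn₁ hn₂ hl₁ hl₂
  obtain ⟨L, hL⟩ := hne
  obtain ⟨s, hs, hs2⟩ := exists_card_filter_le_two (htotal ▸ hlt) hL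
  obtain ⟨hLl, hLP, hLbad⟩ := mem_badLines.1 hL
  have hsP : s ∈ P := hLP hs
  have hPs := image_add_submodule hsP
  -- The image of `P` is the plane `Q`, and this persists when the origin moves to a point `s` of a
  -- bad line that lies on at most two bad lines.
  set g := recenter f s with hgdef
  have g0 : g 0 = 0 := recenter_zero f s
  have hgPQ : g '' P = (Q : Set V) := image_eq_of_image_subset hP hQ fun z hz =>
    Q.add_mem (Q.neg_mem (hPQ s hsP)) (hPQ _ (P.add_mem hsP hz))
  have hc1 := card_badLines_recenter (F := F) f s hPs
  have hc2 := card_badLinesThrough_recenter (F := F) f s hPs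
  -- No bad line through `s` contradicts the choice of `L`; exactly two give 2(q - 1) + 2 = 2q bad
  -- lines in `P`.
  rcases good_or_two_bad g0 hgPQ (hc2.trans_le hs2) with h | ⟨a, ha, b, hb, hab, hA, hB, hrest⟩
  · have := badLinesThrough_eq_empty h
    rw [← hgdef, this, Finset.card_empty, eq_comm, Finset.card_eq_zero] at hc2
    exact Finset.notMem_empty L (hc2 ▸ Finset.mem_filter.2 ⟨hL, hs⟩)
  · obtain ⟨a', b', hab', him⟩ := exists_image_union_eq g0 hgPQ ha hb hab hA hrest
    have h1 := card_badLinesOff_of_two_bad hq g0 hP ha hb hab hA hB hrest hab' him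
    have h2 := two_le_card_badLinesThrough ha hb hab hA hB
    have h3 := card_badLines (F := F) g (P : Set V)
    rw [← hgdef] at hc1
    omega

end PlaneBound

/-! ### Good lines and additivity. -/

section Additive

variable {F V : Type*} [Field F] [AddCommGroup V] [Module F V] {f : Equiv.Perm V}

/-- Additivity on independent pairs makes lines not through the origin good. -/
theorem isLine_image_of_apply_add (h0 : f 0 = 0) {x v : V} (hxv : LinearIndependent F ![x, v])
    (hg : IsLine F (f '' line F 0 v)) (hadd : ∀ t : F, t ≠ 0 → f (x + t • v) = f x + f (t • v)) :
    IsLine F (f '' line F x v) := by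
  have hv0 := indep_right_ne_zero hxv
  have hadd' : ∀ t : F, f (x + t • v) = f x + f (t • v) := by
    intro t
    by_cases ht : t = 0
    · simp [ht, h0]
    · exact hadd t ht
  refine ⟨f x, f v, apply_ne_zero h0 hv0, ?_⟩
  have h1 := image_line_zero h0 hv0 hg
  ext z
  constructor
  · rintro ⟨_, ⟨t, rfl⟩, rfl⟩
    obtain ⟨s, hs⟩ := mem_line_zero.1 (apply_smul_mem h0 hv0 hg t)
    exact ⟨s, by simp only [hadd', hs]⟩
  · rintro ⟨s, rfl⟩
    have h2 : s • f v ∈ f '' line F 0 v := by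
      rw [h1]
      exact smul_mem_line_zero (mem_line_zero_self _) _
    obtain ⟨y, hy, hys⟩ := h2
    obtain ⟨t, rfl⟩ := mem_line_zero.1 hy
    exact ⟨_, ⟨t, rfl⟩, by simp only [hadd', hys]⟩

/-- If all lines in the plane spanned by `x` and `y` are good, then `f (x + y) = f x + f y`. -/
theorem apply_add_of_good [Fintype F] (hq : 3 ≤ Fintype.card F) (h0 : f 0 = 0) {x y : V}
    (hxy : LinearIndependent F ![x, y])
    (hg : ∀ L : Set V, IsLine F L → L ⊆ Submodule.span F {x, y} → IsLine F (f '' L)) :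
    f (x + y) = f x + f y := by
  have hx0 := indep_left_ne_zero hxy
  have hy0 := indep_right_ne_zero hxy
  have hxP : x ∈ Submodule.span F {x, y} := Submodule.subset_span (by simp)
  have hyP : y ∈ Submodule.span F {x, y} := Submodule.subset_span (by simp)
  have hpi := LinearIndependent.pair_iff.1 hxy
  have hgl : ∀ u v : V, u ∈ Submodule.span F {x, y} → v ∈ Submodule.span F {x, y} → v ≠ 0 →
      IsLine F (f '' line F u v) := fun u v hu hv hv0 =>
    hg _ (isLine_line _ hv0) (line_subset_submodule hu hv)
  have hX := hgl 0 x (Submodule.zero_mem _) hxP hx0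
  have hY := hgl 0 y (Submodule.zero_mem _) hyP hy0
  have hspan : f (x + y) ∈ Submodule.span F {f x, f y} := by
    -- The line joining `c⁻¹ • x` to `(1 - c)⁻¹ • y` passes through `x + y`. Avoiding both 0 and 1
    -- requires q ≥ 3.
    obtain ⟨c, hc0, hc1⟩ := exists_ne_zero_ne hq (1 : F)
    have hc2 : 1 - c ≠ 0 := sub_ne_zero.2 hc1.symm
    have hne : c⁻¹ • x ≠ (1 - c)⁻¹ • y := by
      intro h
      have := (hpi c⁻¹ (-(1 - c)⁻¹) (by
        rw [neg_smul, ← sub_eq_add_neg, sub_eq_zero]; exact h)).1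
      exact inv_ne_zero hc0 this
    have hl := hgl ((1 - c)⁻¹ • y) (c⁻¹ • x - (1 - c)⁻¹ • y) (Submodule.smul_mem _ _ hyP)
      (Submodule.sub_mem _ (Submodule.smul_mem _ _ hxP) (Submodule.smul_mem _ _ hyP))
      (sub_ne_zero.2 hne)
    refine hl.subset_submodule (f.injective.ne hne)
      ⟨_, by simpa using add_mem_line (F := F) ((1 - c)⁻¹ • y) (c⁻¹ • x - (1 - c)⁻¹ • y), rfl⟩
      ⟨_, left_mem_line _ _, rfl⟩
      (apply_smul_mem_submodule h0 hx0 hX (Submodule.subset_span (by simp)) _)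
      (apply_smul_mem_submodule h0 hy0 hY (Submodule.subset_span (by simp)) _)
      ⟨x + y, ⟨c, ?_⟩, rfl⟩
    have : (1 - c)⁻¹ • y + c • (c⁻¹ • x - (1 - c)⁻¹ • y) =
        (c * c⁻¹) • x + ((1 - c) * (1 - c)⁻¹) • y := by module
    simp only [this, mul_inv_cancel₀ hc0, mul_inv_cancel₀ hc2, one_smul]
  -- If `α ≠ 1`, the line through `f u` and `f (u + v)` meets the line of `f v`. These are the
  -- images of two disjoint parallel lines of direction `v`, so injectivity fails.
  have key : ∀ u v : V, LinearIndependent F ![u, v] → u ∈ Submodule.span F {x, y} →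
      v ∈ Submodule.span F {x, y} → ∀ α β : F, f (u + v) = α • f u + β • f v → α = 1 := by
    intro u v huv hu hv α β h
    have hv0 := indep_right_ne_zero huv
    by_contra hα
    have hl : f '' line F u v = line F (f u) (f (u + v) - f u) := by
      refine (hgl u v hu hv hv0).eq_line ⟨_, left_mem_line _ _, rfl⟩ ⟨_, add_mem_line _ _, rfl⟩ ?_
      intro he
      exact hv0 (by simpa using f.injective he)
    have hα' : 1 - α ≠ 0 := sub_ne_zero.2 (Ne.symm hα)
    have hmem : ((1 - α)⁻¹ * β) • f v ∈ f '' line F u v := by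
      rw [hl, h]
      refine ⟨(1 - α)⁻¹, ?_⟩
      have : f u + (1 - α)⁻¹ • (α • f u + β • f v - f u) =
          (1 - (1 - α) * (1 - α)⁻¹) • f u + ((1 - α)⁻¹ * β) • f v := by module
      simp only [this, mul_inv_cancel₀ hα', sub_self, zero_smul, zero_add]
    have hmem' : ((1 - α)⁻¹ * β) • f v ∈ f '' line F 0 v := by
      rw [image_line_zero h0 hv0 (hgl 0 v (Submodule.zero_mem _) hv hv0)]
      exact smul_mem_line_zero (mem_line_zero_self _) _
    obtain ⟨z, ⟨s, rfl⟩, hz⟩ := hmem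
    obtain ⟨z', hz'1, hz'⟩ := hmem'
    obtain ⟨t, rfl⟩ := mem_line_zero.1 hz'1
    have he := f.injective (hz.trans hz'.symm)
    have := (LinearIndependent.pair_iff.1 huv 1 (s - t) (by
      have := sub_eq_zero.2 he
      rw [← this]; module)).1
    exact one_ne_zero this
  obtain ⟨α, β, h⟩ := Submodule.mem_span_pair.1 hspan
  have hα := key x y hxy hxP hyP α β h.symm
  have hβ := key y x (indep_symm hxy) hyP hxP β α (by rw [add_comm y x, ← h, add_comm])
  rw [← h, hα, hβ, one_smul, one_smul]

end Additive

/-! ### From planes to the whole space: the gap theorem. -/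

section Global

variable {F V : Type*} [Field F] [AddCommGroup V] [Module F V] [Fintype V]
  {f : Equiv.Perm V}

variable (F) in
/-- The planes through the origin containing `a`. -/
noncomputable def planesThrough (a : V) : Finset (Submodule F V) :=
  Finset.univ.filter fun P => Module.finrank F P = 2 ∧ a ∈ P

theorem mem_planesThrough {a : V} {P : Submodule F V} :
    P ∈ planesThrough F a ↔ Module.finrank F P = 2 ∧ a ∈ P := by
  simp [planesThrough]

/-- A line missing 0 lies in exactly one plane through 0, so counting plane by plane repeats
nothing. -/
theorem sum_card_badLinesOff_le (S : Finset (Submodule F V))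
    (hS : ∀ P ∈ S, Module.finrank F P = 2) :
    ∑ P ∈ S, (badLinesOff F f P).card ≤ (badLinesOff F f Set.univ).card := by
  rw [← Finset.card_biUnion]
  · apply Finset.card_le_card
    intro L hL
    obtain ⟨P, -, hP⟩ := Finset.mem_biUnion.1 hL
    rw [mem_badLinesOff] at hP ⊢
    exact ⟨⟨hP.1.1, Set.subset_univ _, hP.1.2.2⟩, hP.2⟩
  · intro P hP P' hP' hne
    rw [Function.onFun, Finset.disjoint_left]
    intro L hL hL'
    rw [mem_badLinesOff] at hL hL'
    obtain ⟨⟨⟨x, v, hv, rfl⟩, hLP, -⟩, hL0⟩ := hL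
    have hind : LinearIndependent F ![v, x] := by
      rw [indep_iff hv]
      intro h
      obtain ⟨t, ht⟩ := mem_line_zero.1 h
      exact hL0 ⟨-t, by rw [← ht]; module⟩
    have hmem : ∀ R : Submodule F V, line F x v ⊆ R → v ∈ R ∧ x ∈ R := by
      intro R hR
      have h1 : x ∈ R := hR (left_mem_line _ _)
      have h2 : x + v ∈ R := hR (add_mem_line _ _)
      exact ⟨by simpa using R.sub_mem h2 h1, h1⟩
    obtain ⟨h1, h2⟩ := hmem P hLP
    obtain ⟨h3, h4⟩ := hmem P' hL'.1.2.1
    exact hne ((span_eq_of_indep (hS P hP) h1 h2 hind).symm.trans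
      (span_eq_of_indep (hS P' hP') h3 h4 hind))

variable [Fintype F]

/-- Each point off the line of `a` spans with `a` exactly one plane, and each such plane contains q²
- q of these points. -/
theorem card_planesThrough {a : V} (ha0 : a ≠ 0) :
    (planesThrough F a).card * (Fintype.card F ^ 2 - Fintype.card F) + Fintype.card F =
      Fintype.card V := by
  let S : Finset V := Finset.univ.filter fun z => z ∉ line F 0 a
  have hS : S.card + Fintype.card F = Fintype.card V := by
    rw [← card_filter_mem_line (F := F) 0 ha0, ← Finset.card_univ (α := V), add_comm]
    exact Finset.card_filter_add_card_filter_not _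
  have hmaps : Set.MapsTo (fun z => Submodule.span F {a, z}) (S : Set V)
      (planesThrough F a : Set (Submodule F V)) := by
    intro z hz
    have hz' : z ∉ line F 0 a := (Finset.mem_filter.1 hz).2
    rw [Finset.mem_coe, mem_planesThrough]
    exact ⟨finrank_span_pair ((indep_iff ha0).2 hz'), Submodule.subset_span (by simp)⟩
  have h1 := Finset.card_eq_sum_card_fiberwise hmaps
  have h2 : ∀ P ∈ planesThrough F a, (S.filter fun z => Submodule.span F {a, z} = P).card =
      Fintype.card F ^ 2 - Fintype.card F := by
    intro P hP
    rw [mem_planesThrough] at hP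
    rw [← card_plane_sdiff_line hP.1 hP.2 ha0, Nat.add_sub_cancel]
    congr 1
    ext z
    simp only [S, Finset.mem_filter, Finset.mem_univ, true_and]
    constructor
    · rintro ⟨hz, rfl⟩
      exact ⟨Submodule.subset_span (by simp), hz⟩
    · rintro ⟨hz, hza⟩
      exact ⟨hza, span_eq_of_indep hP.1 hP.2 hz ((indep_iff ha0).2 hza)⟩
  rw [Finset.sum_congr rfl h2, Finset.sum_const, smul_eq_mul] at h1
  omega

/-- If exactly two lines through the origin are bad, then there are at least `2 q N` bad lines,
where `N` is the number of planes containing a given line. -/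
theorem card_badLines_of_two_bad (hq : 3 ≤ Fintype.card F) {N : ℕ}
    (hN : N * (Fintype.card F ^ 2 - Fintype.card F) + Fintype.card F = Fintype.card V)
    (h0 : f 0 = 0) {a b : V}
    (hab : LinearIndependent F ![a, b]) (hA : ¬ IsLine F (f '' line F 0 a))
    (hB : ¬ IsLine F (f '' line F 0 b))
    (hg : ∀ z, z ∉ line F 0 a → z ∉ line F 0 b → IsLine F (f '' line F 0 z)) :
    2 * Fintype.card F * N ≤ (badLines F f Set.univ).card := by
  have hqq : 0 < Fintype.card F ^ 2 - Fintype.card F := by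
    rw [Nat.sub_pos_iff_lt]
    nlinarith
  have hcard : ∀ u : V, u ≠ 0 → (planesThrough F u).card = N := by
    intro u hu
    have h1 := card_planesThrough (F := F) hu
    exact Nat.eq_of_mul_eq_mul_right hqq (by omega)
  have hU : f '' ((⊤ : Submodule F V) : Set V) = ((⊤ : Submodule F V) : Set V) := by
    simp [Set.image_univ, f.surjective.range_eq]
  obtain ⟨a', b', hab', him⟩ := exists_image_union_eq h0 hU (Submodule.mem_top)
    (Submodule.mem_top) hab hA (fun z _ => hg z)
  have ha0 := indep_left_ne_zero hab
  have hb0 := indep_right_ne_zero hab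
  set R := Submodule.span F {a, b} with hR
  have haR : a ∈ R := Submodule.subset_span (by simp)
  have hbR : b ∈ R := Submodule.subset_span (by simp)
  have hRf : Module.finrank F R = 2 := finrank_span_pair hab
  have hRa : R ∈ planesThrough F a := mem_planesThrough.2 ⟨hRf, haR⟩
  have hRb : R ∈ planesThrough F b := mem_planesThrough.2 ⟨hRf, hbR⟩
  -- A plane through `u` that omits `w` meets the other bad line only in 0. So its only bad line
  -- through 0 is that of `u`, and by injectivity no other point of it is sent into the two image
  -- lines.
  have hone : ∀ u w : V, LinearIndependent F ![u, w] → ¬ IsLine F (f '' line F 0 u) →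
      (∀ z, z ∉ line F 0 u → z ∉ line F 0 w → IsLine F (f '' line F 0 z)) →
      f '' (line F 0 u ∪ line F 0 w) = line F 0 a' ∪ line F 0 b' →
      ∀ P ∈ planesThrough F u, w ∉ P → Fintype.card F ≤ (badLinesOff F f P).card := by
    intro u w huw hUb hgood himage P hP hw
    rw [mem_planesThrough] at hP
    have hzw : ∀ z ∈ P, z ∉ line F 0 u → z ∉ line F 0 w := by
      intro z hz hzu hzw
      have hz0 : z ≠ 0 := fun h => hzu (h ▸ left_mem_line _ _)
      apply hw
      apply line_subset_submodule P.zero_mem hz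
      rw [← line_zero_eq_of_mem hzw hz0]
      exact mem_line_zero_self w
    refine card_badLinesOff_of_one_bad hq h0 hP.1 hP.2 (indep_left_ne_zero huw) hUb
      (fun z hz hzu => hgood z hzu (hzw z hz hzu)) hab'
      (fun z hz => himage ▸ ⟨z, Or.inl hz, rfl⟩) ?_
    intro z hz hzu h
    rw [← himage] at h
    obtain ⟨y, hy, hyz⟩ := h
    rw [f.injective hyz] at hy
    exact hy.elim hzu (hzw z hz hzu)
  have hnb : ∀ P ∈ (planesThrough F a).erase R, b ∉ P := by
    intro P hP hb
    rw [Finset.mem_erase, mem_planesThrough] at hP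
    exact hP.1 (span_eq_of_indep hP.2.1 hP.2.2 hb hab).symm
  have hna : ∀ P ∈ (planesThrough F b).erase R, a ∉ P := by
    intro P hP ha
    rw [Finset.mem_erase, mem_planesThrough] at hP
    exact hP.1 (span_eq_of_indep hP.2.1 ha hP.2.2 hab).symm
  have hd1 : Disjoint ((planesThrough F a).erase R) ((planesThrough F b).erase R) := by
    rw [Finset.disjoint_left]
    intro P hP hP'
    exact hnb P hP (mem_planesThrough.1 (Finset.mem_of_mem_erase hP')).2
  have hd2 : R ∉ (planesThrough F a).erase R ∪ (planesThrough F b).erase R := by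
    simp
  have hsum := sum_card_badLinesOff_le (f := f)
    (insert R ((planesThrough F a).erase R ∪ (planesThrough F b).erase R)) (by
      intro P hP
      simp only [Finset.mem_insert, Finset.mem_union, Finset.mem_erase, mem_planesThrough] at hP
      rcases hP with rfl | hP | hP
      · exact hRf
      · exact hP.2.1
      · exact hP.2.1)
  rw [Finset.sum_insert hd2, Finset.sum_union hd1] at hsum
  have hs1 := Finset.card_nsmul_le_sum ((planesThrough F a).erase R)
    (fun P => (badLinesOff F f P).card) (Fintype.card F) fun P hP =>
      hone a b hab hA hg him P (Finset.mem_of_mem_erase hP) (hnb P hP)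
  have hs2 := Finset.card_nsmul_le_sum ((planesThrough F b).erase R)
    (fun P => (badLinesOff F f P).card) (Fintype.card F) fun P hP =>
      hone b a (indep_symm hab) hB (fun z h1 h2 => hg z h2 h1) (by rw [Set.union_comm, him]) P
        (Finset.mem_of_mem_erase hP) (hna P hP)
  rw [Finset.card_erase_of_mem hRa, hcard a ha0, smul_eq_mul] at hs1
  rw [Finset.card_erase_of_mem hRb, hcard b hb0, smul_eq_mul] at hs2
  have hs3 := card_badLinesOff_of_two_bad hq h0 hRf haR hbR hab hA hB (fun z _ => hg z) hab' him
  have hs4 := two_le_card_badLinesThrough (f := f) (U := ⊤) (Submodule.mem_top) (Submodule.mem_top)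
    hab hA hB
  rw [Submodule.top_coe] at hs4
  have hs5 := card_badLines (F := F) f Set.univ
  have hN1 : 1 ≤ N := by
    rw [← hcard a ha0]
    exact Finset.card_pos.2 ⟨R, hRa⟩
  -- There are 2M planes with q bad lines off 0 each, the common plane with 2q - 2, and two bad
  -- lines through 0: 2qM + 2q in total.
  obtain ⟨M, rfl⟩ : ∃ M, N = M + 1 := ⟨N - 1, by omega⟩
  rw [Nat.add_sub_cancel] at hs1 hs2
  nlinarith

/-- If all lines through the origin are good and there are fewer than `2 q N` bad lines,
then there are none. -/
theorem badLines_eq_empty_of_good (hq : 3 ≤ Fintype.card F) {N : ℕ}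
    (hN : N * (Fintype.card F ^ 2 - Fintype.card F) + Fintype.card F = Fintype.card V)
    (h0 : f 0 = 0) (hg : ∀ z : V, z ≠ 0 → IsLine F (f '' line F 0 z))
    (hlt : (badLines F f Set.univ).card < 2 * Fintype.card F * N) :
    badLines F f Set.univ = ∅ := by
  let 𝒮 : Finset (Submodule F V) :=
    Finset.univ.filter fun P => Module.finrank F P = 2 ∧ (badLines F f P).Nonempty
  have h𝒮 : ∀ P, P ∈ 𝒮 ↔ Module.finrank F P = 2 ∧ (badLines F f P).Nonempty := by
    intro P
    simp [𝒮]
  have hgP : ∀ P : Submodule F V, Module.finrank F P = 2 → P ∉ 𝒮 →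
      ∀ L : Set V, IsLine F L → L ⊆ P → IsLine F (f '' L) := by
    intro P hP hP𝒮 L hL hLP
    by_contra hbad
    exact hP𝒮 ((h𝒮 P).2 ⟨hP, L, mem_badLines.2 ⟨hL, hLP, hbad⟩⟩)
  have hcard : 𝒮.card < N := by
    have h1 := sum_card_badLinesOff_le (f := f) 𝒮 (fun P hP => ((h𝒮 P).1 hP).1)
    have h2 := Finset.card_nsmul_le_sum 𝒮 (fun P => (badLinesOff F f P).card)
      (2 * Fintype.card F) fun P hP => card_badLinesOff_of_good hq h0 ((h𝒮 P).1 hP).1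
        (fun z _ => hg z) ((h𝒮 P).1 hP).2
    have h3 := card_badLines (F := F) f Set.univ
    rw [smul_eq_mul] at h2
    by_contra! h4
    have := Nat.mul_le_mul_left (2 * Fintype.card F) h4
    nlinarith
  have hadd : ∀ P ∈ 𝒮, ∀ x ∈ P, ∀ y ∈ P, LinearIndependent F ![x, y] →
      f (x + y) = f x + f y := by
    intro P hP x hx y hy hxy
    have hPf := ((h𝒮 P).1 hP).1
    have hx0 := indep_left_ne_zero hxy
    have hy0 := indep_right_ne_zero hxy
    have hpi := LinearIndependent.pair_iff.1 hxy
    have hs0 : x + y ≠ 0 := by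
      intro h
      exact one_ne_zero (hpi 1 1 (by simpa using h)).1
    -- These `z` are unusable because of `Q`: it may be the plane of one of the three additions (x +
    -- y) + z, x + (y + z), y + z.
    let T : Submodule F V → Finset V := fun Q => Finset.univ.filter fun z =>
      z ∉ P ∧ ((x + y ∈ Q ∧ z ∈ Q) ∨ (x ∈ Q ∧ y + z ∈ Q) ∨ (y ∈ Q ∧ z ∈ Q))
    -- Since `Q` meets `P` in at most a line, it contains at most one of `x`, `y`, `x + y`. So only
    -- one of the three conditions can occur, and it puts `z` or `y + z` into `Q` minus `P`.
    have hTcard : ∀ Q ∈ 𝒮.erase P, (T Q).card ≤ Fintype.card F ^ 2 - Fintype.card F := by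
      intro Q hQ
      rw [Finset.mem_erase, h𝒮] at hQ
      have huniq : ∀ u ∈ P, ∀ w ∈ P, LinearIndependent F ![u, w] → u ∈ Q → w ∉ Q := by
        intro u hu w hw huw huQ hwQ
        exact hQ.1 ((span_eq_of_indep hQ.2.1 huQ hwQ huw).symm.trans
          (span_eq_of_indep hPf hu hw huw))
      have hsP := P.add_mem hx hy
      have hxs : LinearIndependent F ![x, x + y] := by
        rw [LinearIndependent.pair_iff]
        intro s t hst
        obtain ⟨h1, h2⟩ := hpi (s + t) t (by rw [← hst]; module)
        exact ⟨by rw [h2] at h1; simpa using h1, h2⟩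
      have hbound : ∀ u ∈ P, u ≠ 0 → u ∈ Q →
          (Finset.univ.filter fun z => z ∉ P ∧ z ∈ Q).card ≤
            Fintype.card F ^ 2 - Fintype.card F := by
        intro u hu hu0 huQ
        rw [← card_plane_sdiff_line hQ.2.1 huQ hu0, Nat.add_sub_cancel]
        apply Finset.card_le_card
        intro z hz
        simp only [Finset.mem_filter, Finset.mem_univ, true_and] at hz ⊢
        exact ⟨hz.2, fun h => hz.1 (line_subset_submodule P.zero_mem hu h)⟩
      by_cases hxQ : x ∈ Q
      · have hyQ := huniq x hx y hy hxy hxQ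
        have hsQ := huniq x hx _ hsP hxs hxQ
        refine le_trans ?_ (hbound x hx hx0 hxQ)
        apply Finset.card_le_card_of_injOn fun z => y + z
        · intro z hz
          simp only [T, Finset.coe_filter, Finset.mem_univ, true_and, Set.mem_ofPred_eq] at hz ⊢
          refine ⟨fun h => hz.1 ?_, ?_⟩
          · simpa using P.sub_mem h hy
          · rcases hz.2 with h | h | h
            · exact absurd h.1 hsQ
            · exact h.2
            · exact absurd h.1 hyQ
        · intro z _ w _ h
          exact add_left_cancel h
      · have hsub : T Q ⊆ Finset.univ.filter fun z => z ∉ P ∧ z ∈ Q := by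
          intro z hz
          simp only [T, Finset.mem_filter, Finset.mem_univ, true_and] at hz ⊢
          refine ⟨hz.1, ?_⟩
          rcases hz.2 with h | h | h
          · exact h.2
          · exact absurd h.1 hxQ
          · exact h.2
        by_cases hyQ : y ∈ Q
        · exact (Finset.card_le_card hsub).trans (hbound y hy hy0 hyQ)
        · by_cases hsQ : x + y ∈ Q
          · exact (Finset.card_le_card hsub).trans (hbound _ hsP hs0 hsQ)
          · have : T Q = ∅ := by
              rw [Finset.eq_empty_iff_forall_notMem]
              intro z hz
              simp only [T, Finset.mem_filter, Finset.mem_univ, hxQ, hyQ, hsQ,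
                false_and, or_self, and_false] at hz
            simp [this]
    obtain ⟨z, hzP, hz⟩ : ∃ z, z ∉ P ∧ ∀ Q ∈ 𝒮, Q ≠ P → ¬ (x + y ∈ Q ∧ z ∈ Q) ∧
        ¬ (x ∈ Q ∧ y + z ∈ Q) ∧ ¬ (y ∈ Q ∧ z ∈ Q) := by
      by_contra! hcon
      -- At most N - 2 other bad planes exclude q² - q points each, whereas (N - 1)(q² - q) points
      -- lie outside `P`.
      have hsub : (Finset.univ.filter fun z => z ∉ P) ⊆ (𝒮.erase P).biUnion T := by
        intro z hz
        have hzP := (Finset.mem_filter.1 hz).2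
        obtain ⟨Q, hQ, hQP, h⟩ := hcon z hzP
        refine Finset.mem_biUnion.2 ⟨Q, Finset.mem_erase.2 ⟨hQP, hQ⟩, ?_⟩
        simp only [T, Finset.mem_filter, Finset.mem_univ, true_and]
        refine ⟨hzP, ?_⟩
        tauto
      have h1 := (Finset.card_le_card hsub).trans (Finset.card_biUnion_le_card_mul _ _ _ hTcard)
      have h2 : (Finset.univ.filter fun z => z ∈ P).card +
          (Finset.univ.filter fun z => z ∉ P).card = Fintype.card V := by
        rw [← Finset.card_univ (α := V)]
        exact Finset.card_filter_add_card_filter_not _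
      rw [card_plane hPf] at h2
      rw [Finset.card_erase_of_mem hP] at h1
      have h3 : 1 ≤ 𝒮.card := Finset.card_pos.2 ⟨P, hP⟩
      obtain ⟨M, hM⟩ : ∃ M, N = M + 2 := ⟨N - 2, by omega⟩
      obtain ⟨e, he⟩ : ∃ e, Fintype.card F ^ 2 = Fintype.card F + e ∧ 0 < e :=
        ⟨Fintype.card F ^ 2 - Fintype.card F, by nlinarith [Nat.sub_add_cancel (show
          Fintype.card F ≤ Fintype.card F ^ 2 by nlinarith)], by
            rw [Nat.sub_pos_iff_lt]; nlinarith⟩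
      rw [he.1, Nat.add_sub_cancel_left] at h1 hN
      rw [he.1] at h2
      have h4 : (𝒮.card - 1) * e ≤ M * e := Nat.mul_le_mul_right _ (by omega)
      rw [hM] at hN
      nlinarith
    have hz0 : z ≠ 0 := fun h => hzP (h ▸ P.zero_mem)
    have hindP : ∀ u ∈ P, u ≠ 0 → ∀ w, w ∉ P → LinearIndependent F ![u, w] := by
      intro u hu hu0 w hw
      rw [indep_iff hu0]
      exact fun h => hw (line_subset_submodule P.zero_mem hu h)
    have hyz : y + z ∉ P := fun h => hzP (by simpa using P.sub_mem h hy)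
    have happ : ∀ u ∈ P, u ≠ 0 → ∀ w, w ∉ P → (∀ Q ∈ 𝒮, Q ≠ P → ¬ (u ∈ Q ∧ w ∈ Q)) →
        f (u + w) = f u + f w := by
      intro u hu hu0 w hw h
      have hi := hindP u hu hu0 w hw
      have huQ : u ∈ Submodule.span F {u, w} := Submodule.subset_span (by simp)
      have hwQ : w ∈ Submodule.span F {u, w} := Submodule.subset_span (by simp)
      refine apply_add_of_good hq h0 hi (hgP _ (finrank_span_pair hi) ?_)
      intro hmem
      refine h _ hmem ?_ ⟨huQ, hwQ⟩
      intro he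
      exact hw (he ▸ hwQ)
    have e1 := happ (x + y) (P.add_mem hx hy) hs0 z hzP fun Q hQ hQP => (hz Q hQ hQP).1
    have e2 := happ x hx hx0 (y + z) hyz fun Q hQ hQP => (hz Q hQ hQP).2.1
    have e3 := happ y hy hy0 z hzP fun Q hQ hQP => (hz Q hQ hQP).2.2
    rw [add_assoc, e2, e3, ← add_assoc] at e1
    exact (add_right_cancel e1).symm
  rw [Finset.eq_empty_iff_forall_notMem]
  intro L hL
  obtain ⟨⟨x, v, hv, rfl⟩, -, hbad⟩ := mem_badLines.1 hL
  have hxv : LinearIndependent F ![v, x] := by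
    rw [indep_iff hv]
    intro h
    obtain ⟨t, ht⟩ := mem_line_zero.1 h
    have h0L : (0 : V) ∈ line F x v := ⟨-t, by rw [← ht]; module⟩
    rw [line_eq_of_mem h0L] at hbad
    exact hbad (hg v hv)
  have hvP : v ∈ Submodule.span F {v, x} := Submodule.subset_span (by simp)
  have hxP : x ∈ Submodule.span F {v, x} := Submodule.subset_span (by simp)
  have hP : Submodule.span F {v, x} ∈ 𝒮 := (h𝒮 _).2 ⟨finrank_span_pair hxv, line F x v,
    mem_badLines.2 ⟨isLine_line x hv, line_subset_submodule hxP hvP, hbad⟩⟩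
  refine hbad (isLine_image_of_apply_add h0 (indep_symm hxv) (hg v hv) fun t ht => ?_)
  refine hadd _ hP x hxP _ (Submodule.smul_mem _ t hvP) ?_
  rw [LinearIndependent.pair_iff]
  intro r s hrs
  obtain ⟨h1, h2⟩ := LinearIndependent.pair_iff.1 hxv (s * t) r (by rw [← hrs]; module)
  exact ⟨h2, (mul_eq_zero.1 h1).resolve_right ht⟩

/-- A permutation with fewer than `2 q N` bad lines has none. -/
theorem badLines_eq_empty (hq : 3 ≤ Fintype.card F) {N : ℕ}
    (hN : N * (Fintype.card F ^ 2 - Fintype.card F) + Fintype.card F = Fintype.card V)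
    (hlt : (badLines F f Set.univ).card < 2 * Fintype.card F * N) :
    badLines F f Set.univ = ∅ := by
  obtain ⟨p, hp⟩ : ∃ p : V, ((badLines F f Set.univ).filter fun L => p ∈ L).card ≤ 2 := by
    -- With three bad lines through every point, incidences give 3|V| ≤ q · #bad < 2q²N. This
    -- contradicts |V| = N(q² - q) + q because q ≥ 3.
    by_contra! h
    have h1 := Finset.sum_card_bipartiteAbove_eq_sum_card_bipartiteBelow
      (s := (Finset.univ : Finset V)) (t := badLines F f Set.univ) (fun p L => p ∈ L)
    have h2 : ∀ L ∈ badLines F f Set.univ, (Finset.bipartiteBelow (fun p L => p ∈ L)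
        (Finset.univ : Finset V) L).card = Fintype.card F := by
      intro L hL
      obtain ⟨⟨x, v, hv, rfl⟩, -⟩ := mem_badLines.1 hL
      exact card_filter_mem_line x hv
    rw [Finset.sum_congr rfl h2, Finset.sum_const, smul_eq_mul] at h1
    have h3 := Finset.card_nsmul_le_sum (Finset.univ : Finset V)
      (fun p => (Finset.bipartiteAbove (fun p L => p ∈ L) (badLines F f Set.univ) p).card) 3
      (fun p _ => h p)
    rw [h1, smul_eq_mul, Finset.card_univ] at h3
    obtain ⟨r, hr⟩ : ∃ r, Fintype.card F = r + 3 := ⟨Fintype.card F - 3, by omega⟩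
    have h4 : Fintype.card F ^ 2 - Fintype.card F = (r + 3) * (r + 2) := by
      rw [hr, Nat.sub_eq_iff_eq_add (by nlinarith)]
      ring
    rw [h4] at hN
    rw [hr] at hN h3 hlt
    have h5 := Nat.mul_le_mul_left (r + 2) h3
    have h6 := Nat.mul_lt_mul_of_pos_left hlt (show 0 < (r + 3) * (r + 2) by positivity)
    nlinarith [Nat.zero_le (r * Fintype.card V)]
  have hU := Set.image_univ_of_surjective (add_left_surjective p)
  have hc1 := card_badLines_recenter (F := F) f p hU
  have hc2 := card_badLinesThrough_recenter (F := F) f p hU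
  have g0 := recenter_zero f p
  set g := recenter f p with hgdef
  have hgU : g '' ((⊤ : Submodule F V) : Set V) = ((⊤ : Submodule F V) : Set V) := by
    simp [Set.image_univ, g.surjective.range_eq]
  rw [← hc1] at hlt
  rw [← Finset.card_eq_zero, ← hc1]
  rcases good_or_two_bad g0 hgU (hc2.trans_le hp) with h | ⟨a, -, b, -, hab, hA, hB, hrest⟩
  · rw [badLines_eq_empty_of_good hq hN g0 (fun z => h z Submodule.mem_top) hlt, Finset.card_empty]
  · have := card_badLines_of_two_bad hq hN g0 hab hA hB (fun z => hrest z Submodule.mem_top)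
    omega

end Global

/-! ### The fundamental theorem of affine geometry. -/

section FundamentalTheorem

variable {F V : Type*} [Field F] [Fintype F] [AddCommGroup V] [Module F V] {f : Equiv.Perm V}

/-- The fundamental theorem of affine geometry for permutations fixing the origin. -/
theorem exists_semilinear (hq : 3 ≤ Fintype.card F) (hV : 2 ≤ Module.finrank F V) (h0 : f 0 = 0)
    (hf : ∀ L : Set V, IsLine F L → IsLine F (f '' L)) :
    ∃ σ : F ≃+* F, (∀ x y, f (x + y) = f x + f y) ∧ ∀ (α : F) (x : V), f (α • x) = σ α • f x := by
  have hind : ∀ x y : V, LinearIndependent F ![x, y] → f (x + y) = f x + f y := fun x y h =>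
    apply_add_of_good hq h0 h fun L hL _ => hf L hL
  have hex : ∀ x : V, ∃ w, w ∉ line F 0 x := by
    intro x
    obtain ⟨w, -, hw⟩ := exists_mem_notMem_line (P := (⊤ : Submodule F V)) (by simpa using hV) x
    exact ⟨w, hw⟩
  have hadd : ∀ x y : V, f (x + y) = f x + f y := by
    intro x y
    by_cases hx : x = 0
    · simp [hx, h0]
    by_cases hy : y = 0
    · simp [hy, h0]
    by_cases hxy : y ∈ line F 0 x
    -- For `y = c • x`, an auxiliary `w` off their line makes the pairs independent; expanding `f (x
    -- + c • x + w)` in two ways cancels `f w`.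
    · obtain ⟨w, hw⟩ := hex x
      have hiw : LinearIndependent F ![x, w] := (indep_iff hx).2 hw
      obtain ⟨c, rfl⟩ := mem_line_zero.1 hxy
      have hc : c ≠ 0 := by
        rintro rfl
        simp at hy
      have hpi := LinearIndependent.pair_iff.1 hiw
      have e1 : f (c • x + w) = f (c • x) + f w := by
        apply hind
        rw [LinearIndependent.pair_iff]
        intro s t hst
        obtain ⟨h1, h2⟩ := hpi (s * c) t (by rw [← hst]; module)
        exact ⟨(mul_eq_zero.1 h1).resolve_right hc, h2⟩
      have e2 : f (x + (c • x + w)) = f x + f (c • x + w) := by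
        apply hind
        rw [LinearIndependent.pair_iff]
        intro s t hst
        obtain ⟨h1, h2⟩ := hpi (s + t * c) t (by rw [← hst]; module)
        rw [h2] at h1
        exact ⟨by simpa using h1, h2⟩
      have e3 : f (x + c • x + w) = f (x + c • x) + f w := by
        by_cases h1 : x + c • x = 0
        · rw [h1, h0, zero_add, zero_add]
        · have hc1 : 1 + c ≠ 0 := by
            intro h
            apply h1
            have : x + c • x = (1 + c) • x := by module
            rw [this, h, zero_smul]
          apply hind
          rw [LinearIndependent.pair_iff]
          intro s t hst
          obtain ⟨h1, h2⟩ := hpi (s * (1 + c)) t (by rw [← hst]; module)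
          exact ⟨(mul_eq_zero.1 h1).resolve_right hc1, h2⟩
      rw [add_assoc, e2, e1, ← add_assoc] at e3
      exact (add_right_cancel e3).symm
    · exact hind x y ((indep_iff hx).2 hxy)
  have hscal : ∀ x : V, x ≠ 0 → ∀ α : F, ∃ β : F, f (α • x) = β • f x := by
    intro x hx α
    obtain ⟨β, hβ⟩ := mem_line_zero.1 (apply_smul_mem h0 hx (hf _ (isLine_line 0 hx)) α)
    exact ⟨β, hβ.symm⟩
  obtain ⟨e, he⟩ := hex 0
  have he0 : e ≠ 0 := by
    rintro rfl
    exact he (left_mem_line _ _)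
  choose σ hσ using hscal e he0
  have hcancel : ∀ x : V, x ≠ 0 → ∀ α β : F, α • f x = β • f x → α = β := fun x hx α β h =>
    smul_left_injective F (apply_ne_zero h0 hx) h
  have hσind : ∀ x : V, LinearIndependent F ![e, x] → ∀ α : F, f (α • x) = σ α • f x := by
    intro x hx α
    have hx0 := indep_right_ne_zero hx
    have hex0 : e + x ≠ 0 := by
      intro h
      exact one_ne_zero (LinearIndependent.pair_iff.1 hx 1 1 (by simpa using h)).1
    obtain ⟨β, hβ⟩ := hscal x hx0 α
    obtain ⟨γ, hγ⟩ := hscal (e + x) hex0 α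
    -- The scalars by which `f` transforms `α • e` and `α • x` both equal the one for `α • (e + x)`,
    -- by comparing coefficients of the independent `f e`, `f x`.
    have hi := indep_image h0 hx (hf _ (isLine_line 0 he0))
    rw [smul_add, hadd, hadd, hσ, hβ] at hγ
    obtain ⟨h1, h2⟩ := LinearIndependent.pair_iff.1 hi (σ α - γ) (β - γ) (by
      have := sub_eq_zero.2 hγ
      rw [← this]; module)
    rw [hβ, sub_eq_zero.1 h2, sub_eq_zero.1 h1]
  have hsmul : ∀ (α : F) (x : V), f (α • x) = σ α • f x := by
    intro α x
    by_cases hx : x ∈ line F 0 e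
    · by_cases hx0 : x = 0
      · simp [hx0, h0]
      -- On the line of `e` itself, `x` is the difference of `x + w` and `w`, both independent of
      -- `e`.
      obtain ⟨w, hw⟩ := hex e
      have hw' : LinearIndependent F ![e, w] := (indep_iff he0).2 hw
      have hxw : LinearIndependent F ![e, x + w] := by
        rw [indep_iff he0]
        intro h
        obtain ⟨c, hc⟩ := mem_line_zero.1 h
        obtain ⟨d, rfl⟩ := mem_line_zero.1 hx
        exact hw (mem_line_zero.2 ⟨c - d, by rw [sub_smul, hc]; abel⟩)
      have h1 := hσind (x + w) hxw α
      rw [smul_add, hadd, hadd, hσind w hw' α, smul_add] at h1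
      exact add_right_cancel h1
    · exact hσind x ((indep_iff he0).2 hx) α
  have hσadd : ∀ α β, σ (α + β) = σ α + σ β := by
    intro α β
    apply hcancel e he0
    rw [← hσ, add_smul, hadd, hσ, hσ, add_smul]
  have hσmul : ∀ α β, σ (α * β) = σ α * σ β := by
    intro α β
    apply hcancel e he0
    rw [← hσ, mul_smul, hsmul, hσ, mul_smul]
  have hσinj : Function.Injective σ := by
    intro α β h
    have h1 : f (α • e) = f (β • e) := by rw [hσ, hσ, h]
    exact smul_left_injective F he0 (f.injective h1)
  let τ : F ≃ F := Equiv.ofBijective σ (Finite.injective_iff_bijective.1 hσinj)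
  exact ⟨{ τ with map_mul' := hσmul, map_add' := hσadd }, hadd, hsmul⟩

end FundamentalTheorem

/-! ### Counting lines, and the bad lines of a transposition. -/

section Lines

variable {F V : Type*} [Field F] [AddCommGroup V] [Module F V] [Fintype V]

variable (F V) in
/-- All lines. -/
noncomputable def lines : Finset (Set V) := Finset.univ.filter fun L => IsLine F L

variable (F) in
/-- The lines through a given point. -/
noncomputable def linesThrough (x : V) : Finset (Set V) := (lines F V).filter fun L => x ∈ L

theorem mem_lines {L : Set V} : L ∈ lines F V ↔ IsLine F L := by
  simp [lines]

theorem mem_linesThrough {x : V} {L : Set V} : L ∈ linesThrough F x ↔ IsLine F L ∧ x ∈ L := by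
  simp [linesThrough, mem_lines]

variable [Fintype F]

theorem card_linesThrough (x : V) :
    (linesThrough F x).card * (Fintype.card F - 1) + 1 = Fintype.card V := by
  have hmaps : Set.MapsTo (fun v => line F x v) ((Finset.univ.erase (0 : V) : Finset V) : Set V)
      (linesThrough F x : Set (Set V)) := by
    intro v hv
    rw [Finset.mem_coe, mem_linesThrough]
    exact ⟨isLine_line x (Finset.ne_of_mem_erase hv), left_mem_line _ _⟩
  have h1 := Finset.card_eq_sum_card_fiberwise hmaps
  have h2 : ∀ L ∈ linesThrough F x,
      ((Finset.univ.erase (0 : V)).filter fun v => line F x v = L).card =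
        Fintype.card F - 1 := by
    intro L hL
    obtain ⟨hLl, hx⟩ := mem_linesThrough.1 hL
    obtain ⟨w, hw, rfl⟩ := hLl.exists_eq hx
    rw [← card_filter_mem_line_zero hw, Nat.add_sub_cancel]
    congr 1
    ext v
    simp only [Finset.mem_filter, Finset.mem_erase, Finset.mem_univ, true_and, and_true]
    constructor
    · rintro ⟨hv, he⟩
      refine ⟨?_, hv⟩
      have : x + v ∈ line F x w := he ▸ add_mem_line _ _
      obtain ⟨t, ht⟩ := this
      exact mem_line_zero.2 ⟨t, add_left_cancel ht⟩
    · rintro ⟨hv, hv0⟩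
      refine ⟨hv0, ?_⟩
      obtain ⟨t, rfl⟩ := mem_line_zero.1 hv
      apply line_smul
      rintro rfl
      simp at hv0
  rw [Finset.sum_congr rfl h2, Finset.sum_const, smul_eq_mul,
    Finset.card_erase_of_mem (Finset.mem_univ _), Finset.card_univ] at h1
  have : 0 < Fintype.card V := Fintype.card_pos
  omega

theorem card_lines_mul {M : ℕ} (hM : ∀ x : V, (linesThrough F x).card = M) :
    Fintype.card V * M = (lines F V).card * Fintype.card F := by
  have h1 := Finset.sum_card_bipartiteAbove_eq_sum_card_bipartiteBelow
    (s := (Finset.univ : Finset V)) (t := lines F V) (fun p L => p ∈ L)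
  have h2 : ∀ L ∈ lines F V, (Finset.bipartiteBelow (fun p L => p ∈ L)
      (Finset.univ : Finset V) L).card = Fintype.card F := by
    intro L hL
    obtain ⟨x, v, hv, rfl⟩ := mem_lines.1 hL
    exact card_filter_mem_line x hv
  have h3 : ∀ p ∈ (Finset.univ : Finset V),
      (Finset.bipartiteAbove (fun p L => p ∈ L) (lines F V) p).card = M := fun p _ => hM p
  rw [Finset.sum_congr rfl h2, Finset.sum_congr rfl h3, Finset.sum_const, Finset.sum_const,
    smul_eq_mul, smul_eq_mul, Finset.card_univ] at h1
  exact h1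

/-- A line containing both or neither of `x`, `y` is mapped to itself. So a bad line passes through
exactly one of them, which excludes the line joining them from both pencils. -/
theorem swap_badLines_card_le {x y : V} (hxy : x ≠ y) {M : ℕ}
    (hM : ∀ x : V, (linesThrough F x).card = M) :
    (badLines F (Equiv.swap x y) Set.univ).card ≤ 2 * (M - 1) := by
  have hyx : y - x ≠ 0 := sub_ne_zero.2 hxy.symm
  have hy : y ∈ line F x (y - x) := by simpa using add_mem_line (F := F) x (y - x)
  have hlx : line F x (y - x) ∈ linesThrough F x :=
    mem_linesThrough.2 ⟨isLine_line _ hyx, left_mem_line _ _⟩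
  have hly : line F x (y - x) ∈ linesThrough F y :=
    mem_linesThrough.2 ⟨isLine_line _ hyx, hy⟩
  have hsub : badLines F (Equiv.swap x y) Set.univ ⊆
      (linesThrough F x).erase (line F x (y - x)) ∪
        (linesThrough F y).erase (line F x (y - x)) := by
    intro L hL
    obtain ⟨hLl, -, hbad⟩ := mem_badLines.1 hL
    have hstable : ¬ ∀ z ∈ L, Equiv.swap x y z ∈ L := by
      intro h
      apply hbad
      apply hLl.image_isLine_of_subset_line _ hLl
      rintro _ ⟨z, hz, rfl⟩
      exact h z hz
    have hiff : ¬ (x ∈ L ↔ y ∈ L) := by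
      intro h
      apply hstable
      intro z hz
      rw [Equiv.swap_apply_def]
      split_ifs with h1 h2
      · exact h.1 (h1 ▸ hz)
      · exact h.2 (h2 ▸ hz)
      · exact hz
    simp only [Finset.mem_union, Finset.mem_erase, mem_linesThrough]
    have hne : L ≠ line F x (y - x) := by
      rintro rfl
      exact hiff ⟨fun _ => hy, fun _ => left_mem_line _ _⟩
    tauto
  refine (Finset.card_le_card hsub).trans ((Finset.card_union_le _ _).trans ?_)
  rw [Finset.card_erase_of_mem hlx, Finset.card_erase_of_mem hly, hM, hM]
  omega

/-- A line through `x` avoiding `y` keeps at least two fixed points, as q ≥ 3. If its image were a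
line, it would be the same line, yet the image contains `y`. -/
theorem swap_badLines_nonempty (hq : 3 ≤ Fintype.card F) (hV : 2 ≤ Module.finrank F V)
    {x y : V} (hxy : x ≠ y) : (badLines F (Equiv.swap x y) Set.univ).Nonempty := by
  obtain ⟨v, -, hv⟩ :=
    exists_mem_notMem_line (P := (⊤ : Submodule F V)) (by simpa using hV) (y - x)
  have hv0 : v ≠ 0 := fun h => hv (h ▸ left_mem_line _ _)
  have hyL : y ∉ line F x v := by
    rintro ⟨t, ht⟩
    have ht0 : t ≠ 0 := by
      rintro rfl
      exact hxy (by simpa using ht)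
    apply hv
    refine mem_line_zero.2 ⟨t⁻¹, ?_⟩
    rw [← ht]
    simp [smul_smul, ht0]
  refine ⟨line F x v, mem_badLines.2 ⟨isLine_line x hv0, Set.subset_univ _, fun h => hyL ?_⟩⟩
  obtain ⟨c, hc0, hc1⟩ := exists_ne_zero_ne hq (1 : F)
  have hfix : ∀ t : F, t ≠ 0 → x + t • v ∈ Equiv.swap x y '' line F x v := by
    intro t ht
    refine ⟨x + t • v, ⟨t, rfl⟩, Equiv.swap_apply_of_ne_of_ne ?_ ?_⟩
    · simp [ht, hv0]
    · exact fun h => hyL ⟨t, h⟩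
  have hne : x + (1 : F) • v ≠ x + c • v := by
    intro h
    exact hc1 (smul_left_injective F hv0 (add_left_cancel h)).symm
  have := h.eq_of_mem (isLine_line x hv0) hne (hfix 1 one_ne_zero) (hfix c hc0) ⟨1, rfl⟩ ⟨c, rfl⟩
  rw [← this]
  exact ⟨x, left_mem_line _ _, Equiv.swap_apply_left _ _⟩

end Lines

/-! ### Translation to flats, affinities and semi-affine maps. -/

section Flats

variable {F : Type*} [Field F] {n : ℕ}

theorem isFlat_one_iff {X : Set (Fin n → F)} : IsFlat 1 X ↔ IsLine F X := by
  constructor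
  · rintro ⟨U, x, hU, rfl⟩
    obtain ⟨v, hv, hv'⟩ := finrank_eq_one_iff'.1 hU
    refine ⟨x, v, fun h => hv (Subtype.ext h), ?_⟩
    ext z
    constructor
    · rintro ⟨u, hu, rfl⟩
      obtain ⟨c, hc⟩ := hv' ⟨u, hu⟩
      refine ⟨c, ?_⟩
      have : c • (v : Fin n → F) = u := congrArg Subtype.val hc
      simp only [this, add_comm]
    · rintro ⟨t, rfl⟩
      exact ⟨t • v, U.smul_mem t v.2, add_comm _ _⟩
  · rintro ⟨x, v, hv, rfl⟩
    refine ⟨Submodule.span F {v}, x, finrank_span_singleton hv, ?_⟩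
    ext z
    constructor
    · rintro ⟨t, rfl⟩
      exact ⟨t • v, Submodule.smul_mem _ _ (Submodule.mem_span_singleton_self v), add_comm _ _⟩
    · rintro ⟨u, hu, rfl⟩
      obtain ⟨t, rfl⟩ := Submodule.mem_span_singleton.1 hu
      exact ⟨t, add_comm _ _⟩

theorem kCoaffinity_one_eq [Fintype F] (f : Equiv.Perm (Fin n → F)) :
    kCoaffinity 1 f = (badLines F f Set.univ).card := by
  rw [kCoaffinity, ← Set.ncard_coe_finset]
  congr 1
  ext L
  simp [isFlat_one_iff, mem_badLines]

theorem kAffinity_add_kCoaffinity_one [Fintype F] (f : Equiv.Perm (Fin n → F)) :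
    kAffinity 1 f + kCoaffinity 1 f = (lines F (Fin n → F)).card := by
  rw [kAffinity, kCoaffinity, ← Set.ncard_union_eq _ (Set.toFinite _) (Set.toFinite _),
    ← Set.ncard_coe_finset]
  · congr 1
    ext L
    simp only [isFlat_one_iff, Set.mem_union, Set.mem_ofPred_eq, Finset.mem_coe, mem_lines]
    tauto
  · rw [Set.disjoint_left]
    rintro L ⟨-, h⟩ ⟨-, h'⟩
    exact h' h

theorem isSemiAffine_of_isLine_image [Fintype F] (hq : 3 ≤ Fintype.card F) (hn : 1 < n)
    {f : Equiv.Perm (Fin n → F)} (hf : ∀ L, IsLine F L → IsLine F (f '' L)) :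
    IsSemiAffine f := by
  have g0 := recenter_zero f 0
  obtain ⟨σ, hadd, hsmul⟩ := exists_semilinear (f := recenter f 0) hq (by rw [Module.finrank_fin_fun]; exact hn) g0
    fun L hL => (isLine_recenter_image f 0 L).2 (hf _ (hL.image_add 0))
  refine ⟨σ, { recenter f 0 with map_add' := hadd }, f 0, fun α x => hsmul α x, fun x => ?_⟩
  change f x = (-f 0 + f (0 + x)) + f 0
  rw [zero_add]
  abel

theorem qBinomial_one (q m : ℕ) : qBinomial q m 1 = ((q : ℚ) ^ m - 1) / ((q : ℚ) - 1) := by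
  simp [qBinomial]

theorem qBinomial_zero (q m : ℕ) : qBinomial q m 0 = 1 := by
  simp [qBinomial]

end Flats

end LineAffinity

/-! ### The three statements, deduced from the gap. -/

open LineAffinity in
theorem corollary8p5 {F : Type*} [Field F] [Fintype F] [DecidableEq F] (q n : ℕ)
    (hF : Fintype.card F = q) (hq : 3 ≤ q) (hn : 1 < n) :
    (∀ f : Equiv.Perm (Fin n → F),
      (kCoaffinity 1 f : ℚ) < 2 * (q : ℚ) ^ 1 * qBinomial q (n - 1) 1 →
        kCoaffinity 1 f = 0 ∧ (∀ L : Set (Fin n → F), IsFlat 1 L → IsFlat 1 (f '' L)) ∧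
          IsSemiAffine f) ∧
    (∀ f : Equiv.Perm (Fin n → F),
      (kAffinity 1 f : ℚ) >
          (((q : ℚ) ^ (n - 1) - 2) * ((q : ℚ) ^ n - 1) / ((q : ℚ) ^ 1 - 1) + 2) *
            qBinomial q (n - 1) (1 - 1) →
        (kAffinity 1 f : ℚ) = (q : ℚ) ^ (n - 1) * qBinomial q n 1) ∧
    (∀ x y : Fin n → F, x ≠ y →
      IsGreatest {a ∈ kSpectrum F n 1 | (a : ℚ) < (q : ℚ) ^ (n - 1) * qBinomial q n 1}
        (kAffinity 1 (Equiv.swap x y))) := by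
  subst hF
  set q := Fintype.card F with hqdef
  have hV : 2 ≤ Module.finrank F (Fin n → F) := by rw [Module.finrank_fin_fun]; exact hn
  have hcV : Fintype.card (Fin n → F) = q ^ n := by simp [hqdef]
  obtain ⟨m, rfl⟩ : ∃ m, n = m + 1 := ⟨n - 1, by omega⟩
  have hq1 : (0 : ℚ) < (q : ℚ) - 1 := by
    have : (3 : ℚ) ≤ q := by exact_mod_cast hq
    linarith
  have hq0 : (0 : ℚ) < q := by linarith
  obtain ⟨e, -, he⟩ :=
    exists_mem_notMem_line (P := (⊤ : Submodule F (Fin (m + 1) → F))) (by simpa using hV) 0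
  have he0 : e ≠ 0 := fun h => he (h ▸ left_mem_line _ _)
  -- `N` counts planes through a line and `M` lines through a point. They are the two `q`-binomials
  -- of the statement, related by M = qN + 1.
  obtain ⟨N, hN⟩ : ∃ N, N * (q ^ 2 - q) + q = Fintype.card (Fin (m + 1) → F) :=
    ⟨_, card_planesThrough (F := F) he0⟩
  obtain ⟨M, hM⟩ : ∃ M, ∀ x : Fin (m + 1) → F, (linesThrough F x).card = M := by
    refine ⟨(linesThrough F (0 : Fin (m + 1) → F)).card, fun x => ?_⟩
    have h1 := card_linesThrough (F := F) x
    have h2 := card_linesThrough (F := F) (0 : Fin (m + 1) → F)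
    exact Nat.eq_of_mul_eq_mul_right (show 0 < Fintype.card F - 1 by omega) (by omega)
  have hMq := card_linesThrough (F := F) (0 : Fin (m + 1) → F)
  have hT := card_lines_mul (F := F) hM
  rw [hM, hcV] at hMq
  rw [hcV] at hT
  have hN' := hN
  rw [hcV] at hN'
  have hMQ : (M : ℚ) * ((q : ℚ) - 1) = (q : ℚ) ^ (m + 1) - 1 := by
    have : ((M * (q - 1) + 1 : ℕ) : ℚ) = ((q ^ (m + 1) : ℕ) : ℚ) := by rw [hMq]
    push_cast [Nat.cast_sub (show 1 ≤ q by omega)] at this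
    linarith
  have hNQ : (N : ℚ) * ((q : ℚ) - 1) = (q : ℚ) ^ m - 1 := by
    have : ((N * (q ^ 2 - q) + q : ℕ) : ℚ) = ((q ^ (m + 1) : ℕ) : ℚ) := by rw [hN']
    push_cast [Nat.cast_sub (show q ≤ q ^ 2 by nlinarith)] at this
    apply mul_left_cancel₀ hq0.ne'
    linear_combination this
  have hMN : (M : ℚ) = q * N + 1 := by
    apply mul_right_cancel₀ hq1.ne'
    rw [hMQ, add_mul, mul_assoc, hNQ, pow_succ]
    ring
  have hMN' : M = q * N + 1 := by exact_mod_cast hMN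
  have hTQ : ((lines F (Fin (m + 1) → F)).card : ℚ) = (q : ℚ) ^ m * M := by
    have : ((q ^ (m + 1) * M : ℕ) : ℚ) = (((lines F (Fin (m + 1) → F)).card * q : ℕ) : ℚ) := by
      rw [hT]
    push_cast at this
    apply mul_right_cancel₀ hq0.ne'
    rw [← this, pow_succ]
    ring
  have hbM : qBinomial q (m + 1) 1 = M := by
    rw [qBinomial_one, ← hMQ, mul_div_cancel_right₀ _ hq1.ne']
  have hbN : qBinomial q (m + 1 - 1) 1 = N := by
    rw [qBinomial_one, Nat.add_sub_cancel, ← hNQ, mul_div_cancel_right₀ _ hq1.ne']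
  rw [hbM, hbN, Nat.sub_self, qBinomial_zero, Nat.add_sub_cancel, ← hTQ]
  have hmain : ∀ f : Equiv.Perm (Fin (m + 1) → F), kCoaffinity 1 f < 2 * q * N →
      badLines F f Set.univ = ∅ := by
    intro f hf
    rw [kCoaffinity_one_eq] at hf
    exact badLines_eq_empty hq hN hf
  refine ⟨fun f hf => ?_, fun f hf => ?_, fun x y hxy => ?_⟩
  · have hempty := hmain f (by rw [pow_one] at hf; exact_mod_cast hf)
    have hlines : ∀ L : Set (Fin (m + 1) → F), IsLine F L → IsLine F (f '' L) := by
      intro L hL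
      by_contra hbad
      have : L ∈ badLines F f Set.univ := mem_badLines.2 ⟨hL, Set.subset_univ _, hbad⟩
      rw [hempty] at this
      exact Finset.notMem_empty L this
    refine ⟨by rw [kCoaffinity_one_eq, hempty, Finset.card_empty], fun L hL => ?_,
      isSemiAffine_of_isLine_image hq hn hlines⟩
    rw [isFlat_one_iff] at hL ⊢
    exact hlines L hL
  · have hsum := kAffinity_add_kCoaffinity_one f
    have hsumQ : (kAffinity 1 f : ℚ) + kCoaffinity 1 f = (q : ℚ) ^ m * M := by
      rw [← hTQ]
      exact_mod_cast hsum
    -- The hypothesis reads affinity > (q^m - 2)M + 2 while the total is q^m M, so the coaffinity is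
    -- below 2(M - 1) = 2qN.
    have hlt : (kCoaffinity 1 f : ℚ) < ((2 * q * N : ℕ) : ℚ) := by
      rw [pow_one, mul_one, ← hMQ, ← mul_assoc, mul_div_cancel_right₀ _ hq1.ne', sub_mul] at hf
      push_cast
      linarith
    have hempty := hmain f (by exact_mod_cast hlt)
    rw [kCoaffinity_one_eq, hempty, Finset.card_empty, add_zero] at hsum
    rw [hsum]
  · have hswap := kAffinity_add_kCoaffinity_one (Equiv.swap x y)
    have hpos : 0 < kCoaffinity 1 (Equiv.swap x y) := by
      rw [kCoaffinity_one_eq]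
      convert Finset.card_pos.2 (swap_badLines_nonempty (F := F) hq hV hxy)
    have hle : kCoaffinity 1 (Equiv.swap x y) ≤ 2 * (M - 1) := by
      rw [kCoaffinity_one_eq]
      convert swap_badLines_card_le (F := F) hxy hM
    refine ⟨⟨⟨_, rfl⟩, by exact_mod_cast (show _ < _ by omega)⟩, ?_⟩
    rintro _ ⟨⟨f, rfl⟩, hf⟩
    have hf' : kAffinity 1 f < (lines F (Fin (m + 1) → F)).card := by exact_mod_cast hf
    have hsum := kAffinity_add_kCoaffinity_one f
    -- Affinity below the total means that some line is bad, hence at least 2qN are, no fewer than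
    -- for the transposition.
    have hge : 2 * q * N ≤ kCoaffinity 1 f := by
      by_contra! hlt
      have h0 := kCoaffinity_one_eq f
      rw [hmain f hlt, Finset.card_empty] at h0
      omega
    have h2 : 2 * (M - 1) = 2 * q * N := by rw [hMN', Nat.add_sub_cancel, mul_assoc]
    simp only
    omega
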